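/- Let $\nu$ be a probability measure on $\mathbb{Z}$ and $\mathfrak p\in[0,1]$. The $\mathfrak p$-ricocheted random walk $(W^*_i,N^*_i)_{i\ge 0}$ started at $(k,0)$ under $\mathbf P^*_k$ is the Markov chain on $\mathbb{Z}^2$ which from a state $(w,n)$ with $w>0$ jumps to $(l,n)$, $l\in\mathbb{Z}$, with probability $(1-\mathfrak p\mathbf 1_{\{l<0\}})\,\nu(l-w)$ and to $(l,n+1)$, $l>0$, with probability $\mathfrak p\,\nu(-l-w)$, and which stays forever at $(w,n)$ if $w\le 0$. It is trapped at $0$, written $W^*_\infty=0$, if $W^*_i=0$ for all sufficiently large $i$. Let $h_0(p)=4^{-p}\binom{2p}{p}\mathbf 1_{\{p\ge 0\}}$ for $p\in\mathbb{Z}$. The law $\nu$ is admissible if $\nu(-1)>0$ and $\sum_{k\in\mathbb{Z}}h_0(l+k)\nu(k)=h_0(l)$ for all $l\ge 1$. For $\mathfrak p\in[-1,1]$ put $b=\frac1\pi\arccos\mathfrak p\in[0,1]$, and define $h^\downarrow_{\mathfrak p}:\mathbb{Z}_{\ge 0}\to\mathbb{R}$ by $h^\downarrow_{\mathfrak p}(0)=1$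 and, for $p\ge 1$, $$h^\downarrow_{\mathfrak p}(p)=\frac{1}{1+\mathfrak p}\,\frac{\Gamma(b)}{\Gamma(2p+1)\Gamma(b-2p)}\;{}_2F_1(-2p,b-1;b-2p;-1)\quad(-1<\mathfrak p<1),$$ $$h^\downarrow_{1}(p)=1,\qquad h^\downarrow_{-1}(p)=\frac{4}{\pi^2p}\sum_{k=1}^p\frac1{2k-1}.$$ **Proposition.** If $\nu$ is admissible and $\mathfrak p\in[0,1]$, then for every integer $p\ge 0$ $$\mathbf P^*_p(W^*_\infty=0)=h^\downarrow_{\mathfrak p}(p).$$ Moreover: 1. For $\mathfrak p\in(-1,1)$ and all complex $x$ with $|x|\le 1$, $x\ne\pm1$, the following series converges (possibly only conditionally if $|x|=1$), with sum $$\sum_{p=0}^\infty h^\downarrow_{\mathfrak p}(p)\,x^{2p}=\frac1{1+\mathfrak p}\Big[\mathfrak p+\cosh\big(2(b-1)\,\mathrm{artanh}\,x\big)\Big],$$ where $\mathrm{artanh}\,x=\frac12\log\frac{1+x}{1-x}$ with the principal logarithm. 2. For every $p\ge 0$ the function $\mathfrak p\mapsto h^\downarrow_{\mathfrak p}(p)$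 is (real-)analytic on $(-1,1)$ and continuous on $[-1,1]$. 3. $h^\downarrow_{\mathfrak p}(p)\in(0,1]$ for all $\mathfrak p\in[0,1]$ and $p\ge 0$. 4. For every $\mathfrak p\in(-1,1]$, as $p\to\infty$, $$h^\downarrow_{\mathfrak p}(p)\sim \mathsf r_{\mathfrak p}\,p^{-b},\qquad \mathsf r_{\mathfrak p}=2\,\Gamma(b)\,\frac{4^{-b}}{\pi}\sqrt{\frac{1-\mathfrak p}{1+\mathfrak p}}\ \ (\mathfrak p<1),\qquad \mathsf r_1=\lim_{\mathfrak p\to1}\mathsf r_{\mathfrak p}=1,$$ and the ratio of the two sides converges to $1$ uniformly in $\mathfrak p$ in any compact subinterval of $(-1,1]$. -/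

import Mathlib

open Filter Topology Asymptotics MeasureTheory ProbabilityTheory
open scoped ENNReal unitInterval

noncomputable section

namespace Ricochet

/-- The function `p ↦ 4^{-p} * binom(2p, p)` on `ℤ`, extended by `0` to negative integers. -/
def h0 (p : ℤ) : ℝ :=
  if 0 ≤ p then ((2 * p.toNat).choose p.toNat : ℝ) / 4 ^ p.toNat else 0

/-- A probability law `ν` on `ℤ` is admissible if `ν(-1) > 0` and `h0` is `ν`-harmonic on the
positive integers. (The series is absolutely convergent, since `h0` takes values in `[0,1]`.) -/
def IsAdmissible (ν : PMF ℤ) : Prop :=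
  0 < ν (-1) ∧ ∀ l : ℤ, 1 ≤ l → ∑' k : ℤ, h0 (l + k) * (ν k).toReal = h0 l

/-- The transition probability of the `q`-ricocheted random walk of law `ν` from the state
`x = (position, number of ricochets)` to the state `y`. From a position `x.1 > 0` the walk moves
to `l ≥ 0` with probability `ν(l - x.1)`, is trapped at `l < 0` with probability
`(1 - q) * ν(l - x.1)`, or ricochets to `l > 0` with probability `q * ν(-l - x.1)`.
Positions `x.1 ≤ 0` are absorbing. -/
def stepProb (ν : PMF ℤ) (q : I) (x y : ℤ × ℤ) : ℝ≥0∞ :=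
  if 0 < x.1 then
    (if y.2 = x.2 then
      ENNReal.ofReal (1 - (q : ℝ) * (if y.1 < 0 then 1 else 0)) * ν (y.1 - x.1) else 0)
    + (if y.2 = x.2 + 1 then
        (if 0 < y.1 then ENNReal.ofReal (q : ℝ) * ν (-y.1 - x.1) else 0) else 0)
  else if y = x then 1 else 0

theorem tsum_stepProb (ν : PMF ℤ) (q : I) (x : ℤ × ℤ) : ∑' y, stepProb ν q x y = 1 := by
  unfold stepProb
  by_cases hx : 0 < x.1
  · simp only [if_pos hx]
    rw [ENNReal.tsum_add, ENNReal.tsum_prod', ENNReal.tsum_prod']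
    simp only [tsum_ite_eq]
    have h2 : ∑' l : ℤ, (if 0 < l then ENNReal.ofReal (q : ℝ) * ν (-l - x.1) else 0)
        = ∑' l : ℤ, (if l < 0 then ENNReal.ofReal (q : ℝ) * ν (l - x.1) else 0) := by
      rw [← (Equiv.neg ℤ).tsum_eq]
      simp
    rw [h2, ← ENNReal.tsum_add]
    have h3 : ∀ l : ℤ, ENNReal.ofReal (1 - (q : ℝ) * (if l < 0 then 1 else 0)) * ν (l - x.1)
        + (if l < 0 then ENNReal.ofReal (q : ℝ) * ν (l - x.1) else 0) = ν (l - x.1) := by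
      intro l
      by_cases hl : l < 0
      · simp only [if_pos hl, mul_one]
        rw [← add_mul, ← ENNReal.ofReal_add (by linarith [q.2.2]) q.2.1]
        simp
      · simp [hl]
    simp only [h3]
    exact ((Equiv.subRight x.1).tsum_eq (fun l => ν l)).trans ν.tsum_coe
  · simp [hx]

/-- The law of the state after one step of the ricocheted random walk started at `x`. -/
def step (ν : PMF ℤ) (q : I) (x : ℤ × ℤ) : PMF (ℤ × ℤ) :=
  ⟨stepProb ν q x, by
    rw [← tsum_stepProb ν q x]
    exact ENNReal.summable.hasSum⟩

/-- The transition kernel of the ricocheted random walk. -/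
def kernel (ν : PMF ℤ) (q : I) : Kernel (ℤ × ℤ) (ℤ × ℤ) :=
  Kernel.ofFunOfCountable fun x => (step ν q x).toMeasure

instance (ν : PMF ℤ) (q : I) : IsMarkovKernel (kernel ν q) :=
  ⟨fun x => by
    change IsProbabilityMeasure (step ν q x).toMeasure
    infer_instance⟩

/-- The law on path space `ℕ → ℤ × ℤ` of the `q`-ricocheted random walk `(W_i, N_i)` of law `ν`
started at `(k, 0)`: the Markov chain with transition kernel `kernel ν q`, where the next state is
drawn given the last entry of the path so far. -/
def walkLaw (ν : PMF ℤ) (q : I) (k : ℤ) : Measure (ℕ → ℤ × ℤ) :=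
  Kernel.trajMeasure (X := fun _ => ℤ × ℤ) (Measure.dirac (k, 0))
    (fun n => (kernel ν q).comap
      (fun w : (Π _ : Finset.Iic n, ℤ × ℤ) => w ⟨n, Finset.mem_Iic.2 le_rfl⟩)
      (measurable_pi_apply _))

/-- The event that the walk is eventually trapped at `0`, that is `W_∞ = 0`. -/
def trappedAtZero : Set (ℕ → ℤ × ℤ) :=
  {w | ∃ n, ∀ m, n ≤ m → (w m).1 = 0}

/-- The exponent `b = arccos(q) / π`. -/
def bExp (q : ℝ) : ℝ := Real.arccos q / Real.pi

/-- The functions `h^↓_q`, for `q ∈ [-1,1]`. -/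
def hDown (q : ℝ) (p : ℕ) : ℝ :=
  if p = 0 then 1
  else if q = 1 then 1
  else if q = -1 then
    4 / (Real.pi ^ 2 * p) * ∑ k ∈ Finset.Icc 1 p, 1 / (2 * (k : ℝ) - 1)
  else
    1 / (1 + q) *
      (Real.Gamma (bExp q) / (Real.Gamma (2 * p + 1) * Real.Gamma (bExp q - 2 * p))) *
      ordinaryHypergeometric (-2 * (p : ℝ)) (bExp q - 1) (bExp q - 2 * p) (-1 : ℝ)

/-- The inverse hyperbolic tangent, with the principal branch of the logarithm. For `‖z‖ ≤ 1`,
`z ≠ 1, -1`, the number `(1 + z) / (1 - z)` is nonzero with nonnegative real part. -/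
def cartanh (z : ℂ) : ℂ := Complex.log ((1 + z) / (1 - z)) / 2

/-- The constant `r_q = 2 Γ(b) 4^{-b} π^{-1} √((1-q)/(1+q))` for `q ∈ (-1,1)`, with its limiting
value `1` at `q = 1`, where `b = 0` and `Γ(b) √(1-q)` has the form `∞ · 0`. -/
def rConst (q : ℝ) : ℝ :=
  if q = 1 then 1
  else 2 * Real.Gamma (bExp q) * ((4 : ℝ) ^ (-bExp q) / Real.pi) * Real.sqrt ((1 - q) / (1 + q))

end Ricochet

end

/-! Write `q` for the ricochet parameter, a = 1 - b, and let c_n be the coefficients of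
((1+x)/(1-x))^a. The terminating hypergeometric sum is a Cauchy product of binomial series, so h(p)
= c_{2p}/(1+q) for p ≥ 1 and q in (-1,1] (`hDown_eq_evenCoeff`).

The analytic claims are facts about e_p = c_{2p}. Each e_p is a polynomial in a. For p ≥ 1 it is
divisible by a², which cancels the zero of 1+q = 2 sin²(πa/2) at q = -1. The e_p with p ≥ 1 decrease
from 2a², and Jordan's inequality gives h ≤ 1. Factoring the function as (1+x)^{2a} (1-x²)^{-a}
shows that e_p divided by (a)_p/p! tends to the even part of (1+x)^{2a} at x = 1, which is 4^a/2.
The limit is taken with a varying along a filter, which gives uniformity. The generating function at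
|x| = 1 follows from Dirichlet's test and Abel's theorem.

The trapping probability rests on the kernel K(p,l) = p/(p+l) u_p u_l with u = `h0`, the law of the
exit from the positive integers, which is the same for all admissible ν. The convolution identity
u_{p+l} = ∑_{j≤l} K(p,j) u_{l-j} can be inverted triangularly, so each K(·,l), extended by a point
mass at -l, is ν-harmonic on the positive integers (`hasSum_exitProb`). It remains to see that h(p)
= K(p,0) + q ∑_{l≥1} K(p,l) h(l) (`hDown_eq_exitKernel_sum`). The sequence e is an eigenvector of a
second-order difference operator that commutes with K up to a rank-one term in u; hence K e = γ(e -
u). Comparing growth at infinity with explicit sequences of order p^{-b} gives γ = 1/cos(πb) = 1/q.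
So the reflected extension of h is ν-harmonic (`ofReal_hDownExt_eq_tsum`).

Since 0 is absorbing, the trapping probability is the increasing limit of the probabilities of being
at 0 at time n, and induction on n bounds these by h. For q < 1 the difference tends to 0 at
infinity, so it attains its maximum; ν(-1) > 0 carries the maximum down to 0, where both functions
equal 1. The case q = 1 follows from monotonicity of the trapping probability and continuity of h in
q. -/

noncomputable section

namespace Ricochet

/-! ### Coefficients of ((1+x)/(1-x))^a: recurrences, positivity, monotonicity -/

section

/-- The coefficient `(s)_n / n!` of `x ^ n` in `(1 - x) ^ (-s)`. -/
def pochCoeff (s : ℝ) (n : ℕ) : ℝ := (ascPochhammer ℝ n).eval s / n.factorial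

@[simp] lemma pochCoeff_zero (s : ℝ) : pochCoeff s 0 = 1 := by simp [pochCoeff]

lemma pochCoeff_succ (s : ℝ) (n : ℕ) :
    pochCoeff s (n + 1) = (s + n) / (n + 1) * pochCoeff s n := by
  have h : ((n : ℝ) + 1) ≠ 0 := by positivity
  have h' : (n.factorial : ℝ) ≠ 0 := by positivity
  simp only [pochCoeff, ascPochhammer_succ_right, Polynomial.eval_mul, Nat.factorial_succ]
  simp
  field_simp

lemma pochCoeff_one (s : ℝ) : pochCoeff s 1 = s := by
  simpa using pochCoeff_succ s 0

lemma pochCoeff_pos {s : ℝ} (hs : 0 < s) (n : ℕ) : 0 < pochCoeff s n := by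
  induction n with
  | zero => simp
  | succ n ih => rw [pochCoeff_succ]; positivity

lemma continuous_pochCoeff (n : ℕ) : Continuous fun s => pochCoeff s n := by
  unfold pochCoeff; fun_prop

/-- The coefficient of `x ^ n` in `((1 + x) / (1 - x)) ^ a`. -/
def cayleyCoeff (a : ℝ) : ℕ → ℝ
  | 0 => 1
  | 1 => 2 * a
  | n + 2 => (2 * a * cayleyCoeff a (n + 1) + n * cayleyCoeff a n) / (n + 2)

/-- The even coefficients of `((1 + x) / (1 - x)) ^ a`. -/
def evenCoeff (a : ℝ) (p : ℕ) : ℝ := cayleyCoeff a (2 * p)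

/-- The odd coefficients of `((1 + x) / (1 - x)) ^ a`. -/
def oddCoeff (a : ℝ) (p : ℕ) : ℝ := cayleyCoeff a (2 * p + 1)

variable {a : ℝ}

lemma cayleyCoeff_rec (a : ℝ) (n : ℕ) : ((n : ℝ) + 2) * cayleyCoeff a (n + 2) =
    2 * a * cayleyCoeff a (n + 1) + n * cayleyCoeff a n := by
  rw [cayleyCoeff]; field_simp

@[simp] lemma evenCoeff_zero (a : ℝ) : evenCoeff a 0 = 1 := rfl

@[simp] lemma oddCoeff_zero (a : ℝ) : oddCoeff a 0 = 2 * a := rfl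

lemma evenCoeff_succ (a : ℝ) (p : ℕ) :
    ((p : ℝ) + 1) * evenCoeff a (p + 1) = a * oddCoeff a p + p * evenCoeff a p := by
  have := cayleyCoeff_rec a (2 * p)
  push_cast at this
  simp only [evenCoeff, oddCoeff, mul_add, mul_one]
  linarith

lemma oddCoeff_succ (a : ℝ) (p : ℕ) : (2 * (p : ℝ) + 3) * oddCoeff a (p + 1) =
    2 * a * evenCoeff a (p + 1) + (2 * p + 1) * oddCoeff a p := by
  have := cayleyCoeff_rec a (2 * p + 1)
  push_cast at this
  simp only [evenCoeff, oddCoeff, mul_add, mul_one]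
  linarith

lemma evenCoeff_one (a : ℝ) : evenCoeff a 1 = 2 * a ^ 2 := by
  have := evenCoeff_succ a 0
  simp at this
  rw [this]; ring

/-- Eliminating the odd coefficients leaves an eigenvalue equation for a second-order difference
operator independent of a, with eigenvalue 2a². The exit kernel is later shown to commute with this
operator up to rank one. -/
lemma evenCoeff_three_term (a : ℝ) (p : ℕ) :
    (2 * (p : ℝ) + 3) * (p + 2) * evenCoeff a (p + 2) - 4 * (p + 1) ^ 2 * evenCoeff a (p + 1)
      + (2 * p + 1) * p * evenCoeff a p = 2 * a ^ 2 * evenCoeff a (p + 1) := by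
  have h1 := evenCoeff_succ a p
  have h2 := evenCoeff_succ a (p + 1)
  have h3 := oddCoeff_succ a p
  push_cast at h2
  linear_combination (2 * (p : ℝ) + 3) * h2 + a * h3 - (2 * (p : ℝ) + 1) * h1

lemma cayleyCoeff_pos (ha : 0 < a) (n : ℕ) : 0 < cayleyCoeff a n := by
  induction n using Nat.strong_induction_on with
  | _ n ih =>
    match n with
    | 0 => simp [cayleyCoeff]
    | 1 => simp [cayleyCoeff, ha]
    | n + 2 =>
      rw [cayleyCoeff]
      have := ih (n + 1) (by omega)
      have := ih n (by omega)
      positivity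

lemma evenCoeff_pos (ha : 0 < a) (p : ℕ) : 0 < evenCoeff a p := cayleyCoeff_pos ha _

lemma oddCoeff_pos (ha : 0 < a) (p : ℕ) : 0 < oddCoeff a p := cayleyCoeff_pos ha _

/-- The two inequalities feed each other through the recurrence, so they are proved together. The
indices start at 1 because 2a² ≤ 1 can fail. The first inequality makes the even coefficients
decrease. -/
lemma cayleyCoeff_ratio (ha : 0 < a) (ha1 : a ≤ 1) (n : ℕ) :
    a * cayleyCoeff a (n + 2) ≤ cayleyCoeff a (n + 1) ∧
      a * cayleyCoeff a (n + 1) ≤ cayleyCoeff a (n + 2) := by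
  induction n with
  | zero =>
    have h : cayleyCoeff a 2 = 2 * a ^ 2 := evenCoeff_one a
    rw [zero_add, zero_add, h]
    change a * (2 * a ^ 2) ≤ 2 * a ∧ a * (2 * a) ≤ 2 * a ^ 2
    constructor
    · nlinarith [mul_nonneg ha.le (sub_nonneg.2 ha1), mul_pos ha ha]
    · nlinarith
  | succ n ih =>
    obtain ⟨h1, h2⟩ := ih
    have h := cayleyCoeff_rec a (n + 1)
    push_cast at h
    have hp := cayleyCoeff_pos ha (n + 2)
    have hn : (0 : ℝ) < (n : ℝ) + 1 + 2 := by positivity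
    have hn' : (0 : ℝ) ≤ (n : ℝ) + 1 := by positivity
    have e : n + 1 + 1 = n + 2 := rfl
    rw [e] at h ⊢
    constructor
    · refine le_of_mul_le_mul_left ?_ hn
      have h3 : a ^ 2 * cayleyCoeff a (n + 2) ≤ cayleyCoeff a (n + 2) := by
        nlinarith [mul_nonneg (mul_nonneg (sub_nonneg.2 ha1) (by linarith : 0 ≤ 1 + a)) hp.le]
      have h4 := mul_le_mul_of_nonneg_left h2 hn'
      calc _ = a * (((n : ℝ) + 1 + 2) * cayleyCoeff a (n + 1 + 2)) := by ring
        _ = 2 * (a ^ 2 * cayleyCoeff a (n + 2)) + ((n : ℝ) + 1) * (a * cayleyCoeff a (n + 1)) := by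
          rw [h]; ring
        _ ≤ _ := by linarith
    · refine le_of_mul_le_mul_left ?_ hn
      rw [h]
      have h4 := mul_le_mul_of_nonneg_left h1 hn'
      nlinarith

lemma evenCoeff_succ_le (ha : 0 < a) (ha1 : a ≤ 1) (p : ℕ) :
    evenCoeff a (p + 2) ≤ evenCoeff a (p + 1) := by
  have h := evenCoeff_succ a (p + 1)
  push_cast at h
  have h2 : a * oddCoeff a (p + 1) ≤ evenCoeff a (p + 1) :=
    (cayleyCoeff_ratio ha ha1 (2 * p + 1)).1
  have hn : (0 : ℝ) < (p : ℝ) + 1 + 1 := by positivity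
  refine le_of_mul_le_mul_left ?_ hn
  rw [h]; linarith

lemma antitone_evenCoeff (ha : 0 < a) (ha1 : a ≤ 1) : Antitone fun p => evenCoeff a (p + 1) :=
  antitone_nat_of_succ_le fun p => evenCoeff_succ_le ha ha1 p

lemma evenCoeff_succ_le_two_mul_sq (ha : 0 < a) (ha1 : a ≤ 1) (p : ℕ) :
    evenCoeff a (p + 1) ≤ 2 * a ^ 2 := by
  simpa [evenCoeff_one] using antitone_evenCoeff ha ha1 (Nat.zero_le p)

lemma evenCoeff_le_two (ha : 0 < a) (ha1 : a ≤ 1) (p : ℕ) : evenCoeff a p ≤ 2 := by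
  cases p with
  | zero => simp
  | succ p => exact (evenCoeff_succ_le_two_mul_sq ha ha1 p).trans (by nlinarith)

lemma mul_oddCoeff_le (ha : 0 < a) (ha1 : a ≤ 1) (p : ℕ) : a * oddCoeff a p ≤ 2 := by
  cases p with
  | zero => simp; nlinarith
  | succ p => exact (cayleyCoeff_ratio ha ha1 (2 * p + 1)).1.trans (evenCoeff_le_two ha ha1 (p + 1))

lemma analyticOnNhd_cayleyCoeff (n : ℕ) :
    AnalyticOnNhd ℝ (fun a => cayleyCoeff a n) Set.univ := by
  induction n using Nat.strong_induction_on with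
  | _ n ih =>
    match n with
    | 0 => simp only [cayleyCoeff]; exact analyticOnNhd_const
    | 1 => simp only [cayleyCoeff]; exact analyticOnNhd_const.mul analyticOnNhd_id
    | n + 2 =>
      simp only [cayleyCoeff]
      exact (((analyticOnNhd_const.mul analyticOnNhd_id).mul (ih (n + 1) (by omega))).add
        (analyticOnNhd_const.mul (ih n (by omega)))).div analyticOnNhd_const
          (fun _ _ => by positivity)

/-! ### Product formulas from the differential equation (1-x²)G' = 2aG -/

section PowerSeries

open PowerSeries

lemma derivative_mk_pochCoeff (s : ℝ) :
    (1 - X) * d⁄dX ℝ (PowerSeries.mk (pochCoeff s)) = C s * PowerSeries.mk (pochCoeff s) := by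
  ext n
  rw [sub_mul, one_mul, map_sub, coeff_derivative, coeff_C_mul, coeff_mk, coeff_mk]
  cases n with
  | zero => simp [pochCoeff_one]
  | succ n =>
    rw [coeff_succ_X_mul, coeff_derivative, coeff_mk, pochCoeff_succ s (n + 1)]
    have : ((n : ℝ) + 1 + 1) ≠ 0 := by positivity
    push_cast
    field_simp
    ring

lemma derivative_mk_neg_one_pow_mul_pochCoeff (s : ℝ) :
    (1 + X) * d⁄dX ℝ (PowerSeries.mk fun n => (-1) ^ n * pochCoeff s n) =
      - C s * PowerSeries.mk fun n => (-1) ^ n * pochCoeff s n := by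
  ext n
  rw [← map_neg, add_mul, one_mul, map_add, coeff_derivative, coeff_C_mul, coeff_mk, coeff_mk]
  cases n with
  | zero => simp [pochCoeff_one]
  | succ n =>
    rw [coeff_succ_X_mul, coeff_derivative, coeff_mk, pochCoeff_succ s (n + 1)]
    have : ((n : ℝ) + 1 + 1) ≠ 0 := by positivity
    push_cast
    field_simp
    ring

/-- The differential equation with G(0) = 1 is the defining recurrence, so any product of binomial
series that solves it has these coefficients. -/
lemma coeff_eq_cayleyCoeff {G : PowerSeries ℝ} (h0 : constantCoeff G = 1)
    (hG : (1 - X ^ 2) * d⁄dX ℝ G = C (2 * a) * G) (n : ℕ) : coeff n G = cayleyCoeff a n := by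
  have key : ∀ n, coeff n ((1 - X ^ 2) * d⁄dX ℝ G) = 2 * a * coeff n G := by
    intro n; rw [hG, coeff_C_mul]
  induction n using Nat.strong_induction_on with
  | _ n ih =>
    match n with
    | 0 => simpa [cayleyCoeff] using h0
    | 1 =>
      have := key 0
      rw [sub_mul, map_sub, one_mul, coeff_derivative] at this
      simpa [pow_two, mul_assoc, h0, cayleyCoeff] using this
    | n + 2 =>
      have h := key (n + 1)
      rw [ih (n + 1) (by omega), sub_mul, one_mul, map_sub, coeff_derivative, pow_two, mul_assoc,
        coeff_succ_X_mul] at h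
      rw [cayleyCoeff]
      have h2 : coeff n (X * d⁄dX ℝ G) = n * cayleyCoeff a n := by
        cases n with
        | zero => simp
        | succ m =>
          rw [coeff_succ_X_mul, coeff_derivative, ih (m + 1) (by omega)]; push_cast; ring
      rw [h2] at h
      push_cast at h
      rw [eq_div_iff (by positivity)]
      linear_combination h

/-- The factorisation (1+x)^a (1-x)^{-a}. -/
lemma cayleyCoeff_eq_sum (a : ℝ) (n : ℕ) : cayleyCoeff a n =
    ∑ x ∈ Finset.HasAntidiagonal.antidiagonal n, (-1) ^ x.1 * pochCoeff (-a) x.1 * pochCoeff a x.2 := by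
  rw [← coeff_eq_cayleyCoeff (G := (PowerSeries.mk fun n => (-1) ^ n * pochCoeff (-a) n) *
    PowerSeries.mk (pochCoeff a)), coeff_mul]
  · simp
  · rw [map_mul, ← coeff_zero_eq_constantCoeff_apply, ← coeff_zero_eq_constantCoeff_apply]; simp
  · have h1 := derivative_mk_pochCoeff a
    have h2 := derivative_mk_neg_one_pow_mul_pochCoeff (-a)
    rw [Derivation.leibniz, smul_eq_mul, smul_eq_mul]
    have h3 : (C (2 * a) : PowerSeries ℝ) = C a + C a := by rw [two_mul, map_add]
    rw [map_neg, neg_neg] at h2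
    rw [h3]
    linear_combination (1 + X) * (PowerSeries.mk fun n => (-1) ^ n * pochCoeff (-a) n) * h1 +
      (1 - X) * PowerSeries.mk (pochCoeff a) * h2

/-- The power series of `(1 - x ^ 2) ^ (-a)`. -/
def evenPochSeries (a : ℝ) : PowerSeries ℝ :=
  PowerSeries.mk fun n => if Even n then pochCoeff a (n / 2) else 0

lemma derivative_evenPochSeries (a : ℝ) :
    (1 - X ^ 2) * d⁄dX ℝ (evenPochSeries a) = C (2 * a) * (X * evenPochSeries a) := by
  ext n
  rw [sub_mul, one_mul, map_sub, coeff_derivative, coeff_C_mul, pow_two, mul_assoc]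
  match n with
  | 0 => simp [evenPochSeries]
  | 1 => simp [coeff_succ_X_mul, evenPochSeries, pochCoeff_one]; ring
  | n + 2 =>
    rw [coeff_succ_X_mul, coeff_succ_X_mul, coeff_succ_X_mul, coeff_derivative]
    simp only [evenPochSeries, coeff_mk]
    rcases Nat.even_or_odd' n with ⟨m, rfl | rfl⟩
    · have h1 : ¬ Even (2 * m + 2 + 1) := by grind
      have h2 : ¬ Even (2 * m + 1) := by grind
      rw [if_neg h1, if_neg h2]; simp
    · have h1 : Even (2 * m + 1 + 2 + 1) := by grind
      have h2 : Even (2 * m + 1 + 1) := by grind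
      rw [if_pos h1, if_pos h2, show (2 * m + 1 + 2 + 1) / 2 = m + 1 + 1 by omega,
        show (2 * m + 1 + 1) / 2 = m + 1 by omega, pochCoeff_succ a (m + 1)]
      have : ((m : ℝ) + 1 + 1) ≠ 0 := by positivity
      push_cast
      field_simp
      ring

/-- The factorisation (1+x)^{2a} (1-x²)^{-a}. The second factor is even, so only even indices of the
first contribute. This form carries the asymptotics, as the even coefficients of (1+x)^{2a} are
summable. -/
lemma evenCoeff_eq_sum (a : ℝ) (p : ℕ) : evenCoeff a p =
    ∑ x ∈ Finset.HasAntidiagonal.antidiagonal p,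
      pochCoeff (-(2 * a)) (2 * x.1) * pochCoeff a x.2 := by
  rw [evenCoeff, ← coeff_eq_cayleyCoeff (G := (PowerSeries.mk fun n => (-1) ^ n *
    pochCoeff (-(2 * a)) n) * evenPochSeries a), coeff_mul]
  · symm
    refine Finset.sum_of_injOn (fun x => (2 * x.1, 2 * x.2)) ?_ ?_ ?_ ?_
    · rintro ⟨i, j⟩ _ ⟨k, l⟩ _ h
      simp only [Prod.mk.injEq] at h ⊢
      omega
    · rintro ⟨i, j⟩ h
      simp only [Finset.mem_coe, Finset.HasAntidiagonal.mem_antidiagonal] at h ⊢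
      omega
    · rintro ⟨i, j⟩ h h'
      simp only [Finset.HasAntidiagonal.mem_antidiagonal] at h
      have hj : ¬ Even j := by
        rintro ⟨k, rfl⟩
        refine h' ⟨(p - k, k), ?_, ?_⟩
        · simp; omega
        · simp; omega
      simp [evenPochSeries, hj]
    · rintro ⟨i, j⟩ _
      simp [evenPochSeries]
  · rw [map_mul, ← coeff_zero_eq_constantCoeff_apply, ← coeff_zero_eq_constantCoeff_apply]
    simp [evenPochSeries]
  · have h1 := derivative_evenPochSeries a
    have h2 := derivative_mk_neg_one_pow_mul_pochCoeff (-(2 * a))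
    rw [Derivation.leibniz, smul_eq_mul, smul_eq_mul]
    rw [map_neg, neg_neg] at h2
    linear_combination (PowerSeries.mk fun n => (-1) ^ n * pochCoeff (-(2 * a)) n) * h1 +
      (1 - X) * evenPochSeries a * h2

end PowerSeries

end

/-! ### The hypergeometric formula -/

lemma Gamma_eq_pochCoeff_mul {b : ℝ} (h : ∀ m : ℤ, b ≠ m) (n : ℕ) :
    Real.Gamma b = (-1) ^ n * (n.factorial * pochCoeff (1 - b) n) * Real.Gamma (b - n) := by
  induction n with
  | zero => simp
  | succ n ih =>
    have h0 : b - (n + 1 : ℕ) ≠ 0 := by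
      intro h1
      exact h (n + 1 : ℕ) (by push_cast at h1 ⊢; linarith)
    have h1 := Real.Gamma_add_one h0
    rw [show b - (n + 1 : ℕ) + 1 = b - n by push_cast; ring] at h1
    rw [ih, h1, pochCoeff_succ, Nat.factorial_succ]
    have : (n : ℝ) + 1 ≠ 0 := by positivity
    push_cast
    field_simp
    ring

/-- Each step in k divides out one factor of the Pochhammer symbol. Evenness of n removes the sign
in Γ(b)/Γ(b-n) = (-1)^n (1-b)_n. -/
lemma Gamma_ratio_mul_ascPochhammer {b : ℝ} (h : ∀ m : ℤ, b ≠ m) {n : ℕ} (hn : Even n) {k : ℕ}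
    (hk : k ≤ n) : Real.Gamma b / (Real.Gamma (n + 1) * Real.Gamma (b - n)) *
      (ascPochhammer ℝ k).eval (-(n : ℝ)) * ((ascPochhammer ℝ k).eval (b - n))⁻¹ =
      pochCoeff (1 - b) (n - k) := by
  induction k with
  | zero =>
    have h1 := Gamma_eq_pochCoeff_mul h n
    rw [hn.neg_one_pow, one_mul] at h1
    have h2 : Real.Gamma (b - n) ≠ 0 := by
      refine Real.Gamma_ne_zero fun m hm => h (n - m : ℤ) ?_
      push_cast; linarith
    have h3 : (n.factorial : ℝ) ≠ 0 := by positivity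
    rw [Real.Gamma_nat_eq_factorial, h1]
    simp
    field_simp
  | succ k ih =>
    have ih := ih (by omega)
    obtain ⟨m, rfl⟩ := Nat.exists_eq_add_of_le hk
    rw [show k + 1 + m - k = m + 1 by omega, pochCoeff_succ] at ih
    rw [show k + 1 + m - (k + 1) = m by omega]
    have h4 : b - (m + 1 : ℝ) ≠ 0 := by
      intro h1
      exact h (m + 1 : ℕ) (by push_cast; linarith)
    have h4' : 1 - b + (m : ℝ) ≠ 0 := by intro h; apply h4; linarith
    have h5 : (m : ℝ) + 1 ≠ 0 := by positivity
    simp only [ascPochhammer_succ_right, Polynomial.eval_mul, Polynomial.eval_add,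
      Polynomial.eval_X, Polynomial.eval_natCast, mul_inv]
    have h6 : b - ((k + 1 + m : ℕ) : ℝ) + k = b - (m + 1) := by push_cast; ring
    have h7 : -((k + 1 + m : ℕ) : ℝ) + k = -(m + 1) := by push_cast; ring
    rw [h6, h7]
    calc _ = (Real.Gamma b / (Real.Gamma ((k + 1 + m : ℕ) + 1) *
        Real.Gamma (b - ((k + 1 + m : ℕ) : ℝ))) *
      (ascPochhammer ℝ k).eval (-((k + 1 + m : ℕ) : ℝ)) *
      ((ascPochhammer ℝ k).eval (b - ((k + 1 + m : ℕ) : ℝ)))⁻¹) * (-(m + 1) * (b - (m + 1))⁻¹) := by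
          ring
      _ = _ := by
        rw [ih]
        field_simp
        ring

lemma hypergeometric_eq_evenCoeff {b : ℝ} (h : ∀ m : ℤ, b ≠ m) (p : ℕ) :
    Real.Gamma b / (Real.Gamma (2 * p + 1) * Real.Gamma (b - 2 * p)) *
      ordinaryHypergeometric (-2 * (p : ℝ)) (b - 1) (b - 2 * p) (-1 : ℝ) = evenCoeff (1 - b) p := by
  simp only [ordinaryHypergeometric_eq_tsum]
  rw [tsum_eq_sum (s := Finset.range (2 * p + 1)), evenCoeff,
    cayleyCoeff_eq_sum, Finset.Nat.sum_antidiagonal_eq_sum_range_succ_mk, Finset.mul_sum]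
  · refine Finset.sum_congr rfl fun k hk => ?_
    have h1 := Gamma_ratio_mul_ascPochhammer h (even_two_mul p) (k := k)
      (by simp at hk; omega)
    push_cast at h1
    rw [← h1, neg_mul, pochCoeff, neg_sub, smul_eq_mul]
    ring
  · intro k hk
    have h1 : 2 * p < k := by simpa using hk
    have h2 := ascPochhammer_eval_neg_coe_nat_of_lt (R := ℝ) h1
    push_cast at h2
    rw [neg_mul, h2]
    simp

/-! ### The exponent b; bounds and regularity in q -/

lemma bExp_nonneg (q : ℝ) : 0 ≤ bExp q := div_nonneg (Real.arccos_nonneg q) Real.pi_pos.le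

lemma bExp_le_one (q : ℝ) : bExp q ≤ 1 := (div_le_one Real.pi_pos).2 (Real.arccos_le_pi q)

lemma bExp_lt_one {q : ℝ} (h : -1 < q) : bExp q < 1 := by
  refine (bExp_le_one q).lt_of_ne fun hq => ?_
  rw [bExp, div_eq_one_iff_eq Real.pi_ne_zero, Real.arccos_eq_pi] at hq
  linarith

lemma bExp_pos {q : ℝ} (h : q < 1) : 0 < bExp q :=
  div_pos (Real.arccos_pos.2 h) Real.pi_pos

lemma bExp_one : bExp 1 = 0 := by simp [bExp]

lemma bExp_zero : bExp 0 = 1 / 2 := by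
  rw [bExp, Real.arccos_zero]; field_simp

lemma bExp_neg_one : bExp (-1) = 1 := by simp [bExp]

lemma cos_pi_mul_bExp {q : ℝ} (h : -1 ≤ q) (h1 : q ≤ 1) : Real.cos (Real.pi * bExp q) = q := by
  rw [bExp, mul_div_cancel₀ _ Real.pi_ne_zero, Real.cos_arccos h h1]

lemma one_add_eq_sin_sq {q : ℝ} (h : -1 ≤ q) (h1 : q ≤ 1) :
    1 + q = 2 * Real.sin (Real.pi * (1 - bExp q) / 2) ^ 2 := by
  have h2 := Real.cos_sq_add_sin_sq (Real.pi * bExp q / 2)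
  have h3 := Real.cos_sq (Real.pi * bExp q / 2)
  rw [show 2 * (Real.pi * bExp q / 2) = Real.pi * bExp q by ring, cos_pi_mul_bExp h h1] at h3
  rw [show Real.pi * (1 - bExp q) / 2 = Real.pi / 2 - Real.pi * bExp q / 2 by ring,
    Real.sin_pi_div_two_sub, h3]
  ring

lemma continuous_bExp : Continuous bExp := Real.continuous_arccos.div_const _

lemma analyticAt_bExp {q : ℝ} (h : q ∈ Set.Ioo (-1 : ℝ) 1) : AnalyticAt ℝ bExp q :=
  (Real.contDiffAt_arccos h.1.ne' h.2.ne).analyticAt.div analyticAt_const Real.pi_ne_zero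

lemma evenCoeff_one_left (p : ℕ) : evenCoeff 1 (p + 1) = 2 ∧ oddCoeff 1 p = 2 := by
  induction p with
  | zero => simp [evenCoeff_one]
  | succ p ih =>
    obtain ⟨h1, h2⟩ := ih
    have h3 := oddCoeff_succ 1 p
    have h4 := evenCoeff_succ 1 (p + 1)
    rw [h1, h2] at h3
    have h5 : oddCoeff 1 (p + 1) = 2 := by
      refine mul_left_cancel₀ (by positivity : 2 * (p : ℝ) + 3 ≠ 0) ?_
      rw [h3]; ring
    refine ⟨?_, h5⟩
    rw [h5, h1] at h4
    refine mul_left_cancel₀ (by positivity : ((p + 1 : ℕ) : ℝ) + 1 ≠ 0) ?_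
    rw [h4]; ring

@[simp] lemma hDown_zero (q : ℝ) : hDown q 0 = 1 := by simp [hDown]

lemma hDown_one (p : ℕ) : hDown 1 p = 1 := by simp [hDown]

lemma hDown_eq_evenCoeff {q : ℝ} (h : -1 < q) (h1 : q ≤ 1) {p : ℕ} (hp : p ≠ 0) :
    hDown q p = evenCoeff (1 - bExp q) p / (1 + q) := by
  rcases h1.eq_or_lt with rfl | h1
  · rw [bExp_one, sub_zero]
    obtain ⟨p, rfl⟩ := Nat.exists_eq_succ_of_ne_zero hp
    rw [(evenCoeff_one_left p).1, hDown_one]; norm_num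
  · have hb : ∀ m : ℤ, bExp q ≠ m := by
      intro m hm
      have h2 := bExp_pos h1
      have h3 := bExp_lt_one h
      rw [hm] at h2 h3
      norm_cast at h2 h3
      omega
    rw [hDown, ← hypergeometric_eq_evenCoeff hb p, if_neg hp, if_neg h1.ne, if_neg h.ne']
    ring

lemma hDown_mem_Ioc {q : ℝ} (h : -1 < q) (h1 : q ≤ 1) (p : ℕ) : hDown q p ∈ Set.Ioc (0 : ℝ) 1 := by
  cases p with
  | zero => simp
  | succ p =>
    have ha : 0 < 1 - bExp q := by linarith [bExp_lt_one h]
    have ha1 : 1 - bExp q ≤ 1 := by linarith [bExp_nonneg q]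
    have hq : 0 < 1 + q := by linarith
    rw [hDown_eq_evenCoeff h h1 p.succ_ne_zero]
    refine ⟨div_pos (evenCoeff_pos ha _) hq, (div_le_one hq).2 ?_⟩
    refine (evenCoeff_succ_le_two_mul_sq ha ha1 p).trans ?_
    rw [one_add_eq_sin_sq h.le h1]
    -- Jordan's inequality; it turns the bound 2a² into 2 sin²(πa/2) = 1 + q.
    have h2 : 1 - bExp q ≤ Real.sin (Real.pi * (1 - bExp q) / 2) := by
      have h3 := Real.mul_le_sin (x := Real.pi * (1 - bExp q) / 2) (by positivity)
        (by nlinarith [Real.pi_pos])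
      have h4 : 2 / Real.pi * (Real.pi * (1 - bExp q) / 2) = 1 - bExp q := by
        field_simp
      rwa [h4] at h3
    have h5 := mul_self_le_mul_self ha.le h2
    nlinarith

/-- Factoring 2a² and 2a out of the recurrences keeps them polynomial. The values at a = 0 are what
remains at q = -1, and they produce the sum of 1/(2k-1). -/
lemma exists_continuous_evenCoeff_eq (p : ℕ) : ∃ F G : ℝ → ℝ, Continuous F ∧ Continuous G ∧
    (∀ a, evenCoeff a (p + 1) = 2 * a ^ 2 * F a) ∧ (∀ a, oddCoeff a p = 2 * a * G a) ∧
    F 0 = 1 / (p + 1) * ∑ k ∈ Finset.Icc 1 (p + 1), 1 / (2 * (k : ℝ) - 1) ∧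
    G 0 = 1 / (2 * p + 1) := by
  induction p with
  | zero =>
    refine ⟨fun _ => 1, fun _ => 1, continuous_const, continuous_const, ?_, ?_, ?_, ?_⟩
    · simp [evenCoeff_one]
    · simp
    · norm_num
    · norm_num
  | succ p ih =>
    obtain ⟨F, G, hF, hG, heF, hoG, hF0, hG0⟩ := ih
    have h3 : (2 * (p : ℝ) + 3) ≠ 0 := by positivity
    have h2 : ((p : ℝ) + 2) ≠ 0 := by positivity
    have hG' : Continuous fun a => (2 * a ^ 2 * F a + (2 * p + 1) * G a) / (2 * p + 3) := by
      fun_prop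
    refine ⟨fun a => ((2 * a ^ 2 * F a + (2 * p + 1) * G a) / (2 * p + 3) + (p + 1) * F a) / (p + 2),
      fun a => (2 * a ^ 2 * F a + (2 * p + 1) * G a) / (2 * p + 3), by fun_prop, hG', ?_⟩
    have ho : ∀ a, oddCoeff a (p + 1) =
        2 * a * ((2 * a ^ 2 * F a + (2 * p + 1) * G a) / (2 * p + 3)) := by
      intro a
      have := oddCoeff_succ a p
      rw [heF, hoG] at this
      refine mul_left_cancel₀ h3 ?_
      rw [this]
      field_simp
    refine ⟨?_, ho, ?_, ?_⟩
    · intro a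
      have := evenCoeff_succ a (p + 1)
      rw [ho, heF] at this
      push_cast at this
      refine mul_left_cancel₀ h2 ?_
      rw [show (p : ℝ) + 2 = p + 1 + 1 by ring, this]
      field_simp
    · beta_reduce
      rw [Finset.sum_Icc_succ_top (by omega), hF0, hG0]
      have h4 : (p : ℝ) + 1 ≠ 0 := by positivity
      have h5 : 2 * (p : ℝ) + 1 ≠ 0 := by positivity
      have h6 : 2 * ((p + 1 + 1 : ℕ) : ℝ) - 1 = 2 * p + 3 := by push_cast; ring
      rw [h6]
      push_cast
      rw [show (p : ℝ) + 1 + 1 = p + 2 by ring]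
      field_simp
      ring
    · beta_reduce
      rw [hG0]
      have h5 : 2 * (p : ℝ) + 1 ≠ 0 := by positivity
      push_cast
      field_simp
      ring

/-- With 1 + q = 2 sin²(πa/2), the quotient 2a²F(a)/(1+q) equals (4/π²) F(a)/sinc²(πa/2), where the
singularity at a = 0 has disappeared. -/
lemma continuousOn_hDown (p : ℕ) : ContinuousOn (fun q => hDown q p) (Set.Icc (-1) 1) := by
  cases p with
  | zero => simp [continuousOn_const]
  | succ p =>
    obtain ⟨F, -, hF, -, heF, -, hF0, -⟩ := exists_continuous_evenCoeff_eq p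
    have hs : ∀ q, Real.sinc (Real.pi * (1 - bExp q) / 2) ≠ 0 := by
      intro q
      have h1 : 0 ≤ 1 - bExp q := by linarith [bExp_le_one q]
      rcases h1.eq_or_lt with h1 | h1
      · rw [← h1]; simp
      · rw [Real.sinc_of_ne_zero (by positivity)]
        refine (div_pos (Real.sin_pos_of_pos_of_lt_pi (by positivity) ?_) (by positivity)).ne'
        nlinarith [Real.pi_pos, bExp_nonneg q]
    have key : ∀ q ∈ Set.Icc (-1 : ℝ) 1, hDown q (p + 1) =
        F (1 - bExp q) * (4 / Real.pi ^ 2) / Real.sinc (Real.pi * (1 - bExp q) / 2) ^ 2 := by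
      rintro q ⟨h, h1⟩
      rcases h.eq_or_lt with rfl | h
      · rw [bExp_neg_one, sub_self, hF0]
        have h4 : (p : ℝ) + 1 ≠ 0 := by positivity
        rw [hDown, if_neg p.succ_ne_zero, if_neg (by norm_num), if_pos rfl]
        simp only [mul_zero, zero_div, Real.sinc_zero]
        push_cast
        field_simp
      · have ha : 0 < 1 - bExp q := by linarith [bExp_lt_one h]
        have hs' := hs q
        rw [Real.sinc_of_ne_zero (by positivity)] at hs' ⊢
        have h2 : Real.sin (Real.pi * (1 - bExp q) / 2) ≠ 0 := fun h0 => hs' (by rw [h0]; simp)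
        rw [hDown_eq_evenCoeff h h1 p.succ_ne_zero, heF, one_add_eq_sin_sq h.le h1]
        field_simp
        ring
    refine ContinuousOn.congr ?_ key
    have hc := continuous_bExp
    have hs2 : Continuous fun q => Real.sinc (Real.pi * (1 - bExp q) / 2) :=
      Real.continuous_sinc.comp (by fun_prop)
    refine (Continuous.div ?_ (hs2.pow 2) fun q => pow_ne_zero 2 (hs q)).continuousOn
    exact (hF.comp (by fun_prop)).mul continuous_const

lemma analyticOnNhd_hDown (p : ℕ) : AnalyticOnNhd ℝ (fun q => hDown q p) (Set.Ioo (-1) 1) := by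
  cases p with
  | zero => simp only [hDown_zero]; exact analyticOnNhd_const
  | succ p =>
    have h : AnalyticOnNhd ℝ (fun q => evenCoeff (1 - bExp q) (p + 1) / (1 + q))
        (Set.Ioo (-1) 1) := by
      intro q hq
      refine AnalyticAt.div ?_ (analyticAt_const.add analyticAt_id) (by linarith [hq.1])
      exact (analyticOnNhd_cayleyCoeff (2 * (p + 1)) _ (Set.mem_univ _)).comp
        (analyticAt_const.sub (analyticAt_bExp hq))
    refine h.congr isOpen_Ioo fun q hq => ?_
    exact (hDown_eq_evenCoeff hq.1 hq.2.le p.succ_ne_zero).symm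

/-! ### Size and sums of the binomial coefficients (s)_n/n! -/

lemma Gamma_mul_pochCoeff {s : ℝ} (hs : 0 < s) (n : ℕ) :
    Real.Gamma s * pochCoeff s n = Real.Gamma (n + s) / n.factorial := by
  induction n with
  | zero => simp
  | succ n ih =>
    have h1 := Real.Gamma_add_one (s := n + s) (by positivity)
    rw [pochCoeff_succ, Nat.factorial_succ, show ((n + 1 : ℕ) : ℝ) + s = n + s + 1 by push_cast; ring,
      h1, mul_left_comm, ih]
    push_cast
    field_simp
    ring

/-- Log-convexity of Γ between n and n+1. The companion lower bound uses it between n+s and n+s+1.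
Together they give Γ(s)(s)_n/n! ~ n^{s-1} with an error uniform in s ∈ (0,1]. -/
lemma Gamma_nat_add_le {s : ℝ} (hs : 0 < s) (hs1 : s ≤ 1) {n : ℕ} (hn : 0 < n) :
    Real.Gamma (n + s) ≤ n.factorial * (n : ℝ) ^ (s - 1) := by
  have hn' : (0 : ℝ) < n := by exact_mod_cast hn
  rcases hs1.eq_or_lt with rfl | hs1
  · simp [Real.Gamma_nat_eq_factorial]
  · have h := Real.Gamma_mul_add_mul_le_rpow_Gamma_mul_rpow_Gamma hn' (by positivity : 0 < (n : ℝ) + 1)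
      (sub_pos.2 hs1) hs (by ring)
    have hG : Real.Gamma n = n.factorial / n := by
      have h1 := Real.Gamma_add_one hn'.ne'
      rw [Real.Gamma_nat_eq_factorial] at h1
      rw [h1]; field_simp
    have hf : (0 : ℝ) < n.factorial := by positivity
    rw [Real.Gamma_nat_eq_factorial, hG, show (1 - s) * n + s * ((n : ℝ) + 1) = n + s by ring] at h
    refine h.trans_eq ?_
    rw [Real.div_rpow hf.le hn'.le, div_mul_eq_mul_div, ← Real.rpow_add hf, sub_add_cancel,
      Real.rpow_one, div_eq_mul_inv, ← Real.rpow_neg hn'.le, neg_sub]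

lemma factorial_le_Gamma_nat_add {s : ℝ} (hs : 0 < s) (hs1 : s ≤ 1) (n : ℕ) :
    (n.factorial : ℝ) ≤ Real.Gamma (n + s) * (n + s) ^ (1 - s) := by
  rcases hs1.eq_or_lt with rfl | hs1
  · simp [Real.Gamma_nat_eq_factorial]
  · have hn : 0 < (n : ℝ) + s := by positivity
    have h := Real.Gamma_mul_add_mul_le_rpow_Gamma_mul_rpow_Gamma hn
      (by positivity : 0 < (n : ℝ) + s + 1) hs (sub_pos.2 hs1) (by ring)
    have hG := Real.Gamma_pos_of_pos hn
    rw [show s * (n + s) + (1 - s) * ((n : ℝ) + s + 1) = n + 1 by ring,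
      Real.Gamma_nat_eq_factorial, Real.Gamma_add_one hn.ne', Real.mul_rpow hn.le hG.le,
      mul_left_comm, ← Real.rpow_add hG, add_sub_cancel, Real.rpow_one] at h
    linarith

lemma Gamma_mul_pochCoeff_mul_rpow_le {s : ℝ} (hs : 0 < s) (hs1 : s ≤ 1) {n : ℕ} (hn : 0 < n) :
    Real.Gamma s * pochCoeff s n * (n : ℝ) ^ (1 - s) ≤ 1 := by
  have hn' : (0 : ℝ) < n := by exact_mod_cast hn
  have hf : (0 : ℝ) < n.factorial := by positivity
  rw [Gamma_mul_pochCoeff hs, div_mul_eq_mul_div, div_le_one hf]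
  calc _ ≤ n.factorial * (n : ℝ) ^ (s - 1) * (n : ℝ) ^ (1 - s) := by
        gcongr; exact Gamma_nat_add_le hs hs1 hn
    _ = _ := by rw [mul_assoc, ← Real.rpow_add hn']; simp

lemma le_Gamma_mul_pochCoeff_mul_rpow {s : ℝ} (hs : 0 < s) (hs1 : s ≤ 1) {n : ℕ} (hn : 0 < n) :
    (n : ℝ) / (n + 1) ≤ Real.Gamma s * pochCoeff s n * (n : ℝ) ^ (1 - s) := by
  have hn' : (0 : ℝ) < n := by exact_mod_cast hn
  have hf : (0 : ℝ) < n.factorial := by positivity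
  have hns : 0 < (n : ℝ) + s := by positivity
  have h1 : (n : ℝ) / (n + 1) ≤ (n : ℝ) ^ (1 - s) / (n + s) ^ (1 - s) := by
    rw [← Real.div_rpow hn'.le hns.le]
    calc (n : ℝ) / (n + 1) ≤ n / (n + s) := by gcongr
      _ = (n / (n + s)) ^ (1 : ℝ) := (Real.rpow_one _).symm
      _ ≤ _ := Real.rpow_le_rpow_of_exponent_ge (by positivity)
          ((div_le_one hns).2 (by linarith)) (by linarith)
  refine h1.trans ?_
  rw [Gamma_mul_pochCoeff hs, div_le_iff₀ (by positivity), div_mul_eq_mul_div, div_mul_eq_mul_div,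
    le_div_iff₀ hf]
  calc _ ≤ (n : ℝ) ^ (1 - s) * (Real.Gamma (n + s) * (n + s) ^ (1 - s)) := by
        gcongr; exact factorial_le_Gamma_nat_add hs hs1 n
    _ = _ := by ring

lemma tendsto_natCast_div_add_one : Tendsto (fun n : ℕ => (n : ℝ) / (n + 1)) atTop (𝓝 1) :=
  tendsto_natCast_div_add_atTop (1 : ℝ)

lemma tendsto_Gamma_mul_pochCoeff_mul_rpow {X : Type*} {l : Filter X} {f : X → ℕ} {g : X → ℝ}
    (hf : Tendsto f l atTop) (hg : ∀ᶠ x in l, g x ∈ Set.Ioc (0 : ℝ) 1) :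
    Tendsto (fun x => Real.Gamma (g x) * pochCoeff (g x) (f x) * (f x : ℝ) ^ (1 - g x)) l (𝓝 1) := by
  refine tendsto_of_tendsto_of_tendsto_of_le_of_le' (tendsto_natCast_div_add_one.comp hf)
    tendsto_const_nhds ?_ ?_
  · filter_upwards [hf.eventually_gt_atTop 0, hg] with x h1 h2
    exact le_Gamma_mul_pochCoeff_mul_rpow h2.1 h2.2 h1
  · filter_upwards [hf.eventually_gt_atTop 0, hg] with x h1 h2
    exact Gamma_mul_pochCoeff_mul_rpow_le h2.1 h2.2 h1

lemma tendsto_pochCoeff_mul_rpow {s : ℝ} (hs : 0 < s) (hs1 : s ≤ 1) :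
    Tendsto (fun n : ℕ => pochCoeff s n * (n : ℝ) ^ (1 - s)) atTop (𝓝 (Real.Gamma s)⁻¹) := by
  have h := (tendsto_Gamma_mul_pochCoeff_mul_rpow (f := id) (g := fun _ => s) tendsto_id
    (Eventually.of_forall fun _ => ⟨hs, hs1⟩)).const_mul (Real.Gamma s)⁻¹
  have hG := (Real.Gamma_pos_of_pos hs).ne'
  refine (h.congr fun n => ?_).trans_eq ?_
  · simp only [id]; field_simp
  · simp

lemma tendsto_pochCoeff_atTop_zero {s : ℝ} (hs : 0 ≤ s) (hs1 : s < 1) :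
    Tendsto (pochCoeff s) atTop (𝓝 0) := by
  rcases hs.eq_or_lt with rfl | hs
  · refine tendsto_const_nhds.congr' ?_
    filter_upwards [eventually_gt_atTop 0] with n hn
    obtain ⟨n, rfl⟩ := Nat.exists_eq_succ_of_ne_zero hn.ne'
    induction n with
    | zero => simp [pochCoeff_one]
    | succ n ih => rw [Nat.succ_eq_add_one, pochCoeff_succ, ← Nat.succ_eq_add_one, ← ih (by omega)]; simp
  · have h1 : Tendsto (fun n : ℕ => (n : ℝ) ^ (-(1 - s))) atTop (𝓝 0) :=
      (tendsto_rpow_neg_atTop (sub_pos.2 hs1)).comp tendsto_natCast_atTop_atTop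
    have h2 := (tendsto_pochCoeff_mul_rpow hs hs1.le).mul h1
    rw [mul_zero] at h2
    refine h2.congr' ?_
    filter_upwards [eventually_gt_atTop 0] with n hn
    have hn' : (0 : ℝ) < n := by exact_mod_cast hn
    rw [mul_assoc, ← Real.rpow_add hn']; simp

lemma sum_pochCoeff (s : ℝ) (n : ℕ) :
    ∑ i ∈ Finset.range (n + 1), pochCoeff s i = pochCoeff (s + 1) n := by
  induction n with
  | zero => simp
  | succ n ih =>
    rw [Finset.sum_range_succ, ih]
    have key : ∀ n : ℕ, (s + n) * pochCoeff s n = s * pochCoeff (s + 1) n := by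
      intro n
      induction n with
      | zero => simp
      | succ n ih =>
        rw [pochCoeff_succ, pochCoeff_succ]
        push_cast
        linear_combination ((s + (n + 1)) / (n + 1)) * ih
    rw [pochCoeff_succ s, pochCoeff_succ (s + 1)]
    have h := key n
    have hn : (n : ℝ) + 1 ≠ 0 := by positivity
    field_simp
    linear_combination h

lemma succ_mul_pochCoeff_succ (s : ℝ) (n : ℕ) :
    ((n : ℝ) + 1) * pochCoeff s (n + 1) = s * pochCoeff (s + 1) n := by
  have h := sum_pochCoeff s (n + 1)
  rw [Finset.sum_range_succ, sum_pochCoeff, pochCoeff_succ (s + 1)] at h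
  have hn : (n : ℝ) + 1 ≠ 0 := by positivity
  field_simp at h
  linear_combination h

lemma sum_range_pochCoeff {s : ℝ} (hs : s ≠ 0) (n : ℕ) :
    ∑ i ∈ Finset.range n, pochCoeff s i = n * pochCoeff s n / s := by
  cases n with
  | zero => simp
  | succ n =>
    rw [sum_pochCoeff]
    have h := succ_mul_pochCoeff_succ s n
    push_cast
    rw [h]; field_simp

/-- Together with `pochCoeff_antitone` this confines the ratio of the coefficients at p-j and p to
[1, p/(p-j)] for j < p, uniformly in s ∈ (0,1]. -/
lemma mul_pochCoeff_mono {s : ℝ} (hs : 0 < s) {m n : ℕ} (h : m ≤ n) :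
    m * pochCoeff s m ≤ n * pochCoeff s n := by
  refine monotone_nat_of_le_succ (f := fun n : ℕ => n * pochCoeff s n) (fun n => ?_) h
  have h2 : ((n + 1 : ℕ) : ℝ) * pochCoeff s (n + 1) = (s + n) * pochCoeff s n := by
    have hn : (n : ℝ) + 1 ≠ 0 := by positivity
    rw [pochCoeff_succ]; push_cast; field_simp
  simp only [h2]
  nlinarith [pochCoeff_pos hs n]

lemma pochCoeff_antitone {s : ℝ} (hs : 0 ≤ s) (hs1 : s ≤ 1) : Antitone (pochCoeff s) := by
  have h0 : ∀ n, 0 ≤ pochCoeff s n := by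
    intro n
    induction n with
    | zero => simp
    | succ n ih => rw [pochCoeff_succ]; positivity
  refine antitone_nat_of_succ_le fun n => ?_
  rw [pochCoeff_succ]
  refine mul_le_of_le_one_left (h0 n) ?_
  rw [div_le_one (by positivity)]; linarith

lemma pochCoeff_nonneg {s : ℝ} (hs : 0 ≤ s) (n : ℕ) : 0 ≤ pochCoeff s n := by
  induction n with
  | zero => simp
  | succ n ih => rw [pochCoeff_succ]; positivity

/-- All terms after the first are nonpositive, and the partial sums are coefficients of (1-x)^{s-1},
hence nonnegative; so the absolute values after the first sum to at most 1. -/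
lemma summable_abs_pochCoeff_neg {s : ℝ} (hs : 0 < s) (hs1 : s < 1) :
    Summable fun n => |pochCoeff (-s) n| := by
  rw [← summable_nat_add_iff 1]
  have h0 : ∀ n, |pochCoeff (-s) (n + 1)| = -pochCoeff (-s) (n + 1) := by
    intro n
    refine abs_of_nonpos ?_
    have h := succ_mul_pochCoeff_succ (-s) n
    have h1 : 0 ≤ pochCoeff (-s + 1) n := pochCoeff_nonneg (by linarith) n
    by_contra! h2
    have : 0 < ((n : ℝ) + 1) * pochCoeff (-s) (n + 1) := by positivity
    nlinarith
  refine summable_of_sum_range_le (c := 1) (fun n => abs_nonneg _) fun n => ?_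
  simp only [h0]
  have h := sum_pochCoeff (-s) n
  rw [Finset.sum_range_succ'] at h
  have h1 : 0 ≤ pochCoeff (-s + 1) n := pochCoeff_nonneg (by linarith) n
  rw [Finset.sum_neg_distrib]
  simp only [pochCoeff_zero] at h
  linarith

lemma multichoose_eq_pochCoeff (s : ℝ) (n : ℕ) : Ring.choose (s + n - 1) n = pochCoeff s n := by
  rw [← Ring.multichoose_eq, pochCoeff, eq_div_iff (by positivity),
    ← Polynomial.ascPochhammer_smeval_eq_eval, ← Ring.factorial_nsmul_multichoose_eq_ascPochhammer,
    nsmul_eq_mul, mul_comm]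

lemma hasSum_pochCoeff (s : ℝ) {x : ℂ} (hx : ‖x‖ < 1) :
    HasSum (fun n => (pochCoeff s n : ℂ) * x ^ n) ((1 - x) ^ (-s : ℂ)) := by
  have h := (Complex.one_div_one_sub_cpow_hasFPowerSeriesOnBall_zero (s : ℂ)).hasSum
    (y := x) (by simpa [← ENNReal.ofReal_one, Metric.eball_ofReal] using hx)
  rw [zero_add, one_div, ← Complex.cpow_neg] at h
  refine (funext fun n => ?_ : (fun n => (pochCoeff s n : ℂ) * x ^ n) = _) ▸ h
  rw [FormalMultilinearSeries.ofScalars_apply_eq, smul_eq_mul, ← multichoose_eq_pochCoeff,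
    Complex.ofReal_choose]
  push_cast
  rfl

/-! ### Asymptotics of the even coefficients and of h -/

lemma hasSum_even_part {f : ℕ → ℂ} {x A B : ℂ} (hA : HasSum (fun n => f n * x ^ n) A)
    (hB : HasSum (fun n => f n * (-x) ^ n) B) :
    HasSum (fun p => f (2 * p) * x ^ (2 * p)) ((A + B) / 2) := by
  have h := (hA.add hB).div_const 2
  rw [← (mul_right_injective₀ (two_ne_zero (α := ℕ))).hasSum_iff] at h
  · refine (funext fun p => ?_ : (fun p => f (2 * p) * x ^ (2 * p)) = _) ▸ h
    simp only [Function.comp_apply, (even_two_mul p).neg_pow]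
    ring
  · intro n hn
    have hn' : Odd n := by
      rw [← Nat.not_even_iff_odd]
      rintro ⟨k, rfl⟩
      exact hn ⟨k, by ring⟩
    rw [hn'.neg_pow]; ring

/-- Compare the ratios of consecutive terms. The right side does not depend on a ≥ s, so it is a
majorant for dominated convergence with a moving parameter. -/
lemma abs_pochCoeff_neg_two_mul_le {a s : ℝ} (hs : 0 < s) (hsa : s ≤ a) (ha1 : a ≤ 1) (hs1 : s < 1)
    (j : ℕ) : |pochCoeff (-(2 * a)) (2 * j)| ≤ |pochCoeff (-s) j| / s := by
  rw [le_div_iff₀ hs]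
  rcases j with _ | j
  · simpa using hs1.le
  · induction j with
    | zero =>
      rw [zero_add, pochCoeff_one, mul_one, pochCoeff_succ, pochCoeff_one, abs_neg, abs_of_pos hs]
      have : |(-(2 * a) + (1 : ℕ)) / ((1 : ℕ) + 1) * -(2 * a)| ≤ 1 := by
        rw [abs_le]; push_cast; constructor <;> nlinarith
      nlinarith
    | succ j ih =>
      rw [show 2 * (j + 1 + 1) = 2 * (j + 1) + 1 + 1 by ring, pochCoeff_succ, pochCoeff_succ _ (2 * (j + 1)),
        pochCoeff_succ (-s) (j + 1)]
      simp only [abs_mul]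
      have h1 : |(-(2 * a) + ((2 * (j + 1) + 1 : ℕ) : ℝ)) / (((2 * (j + 1) + 1 : ℕ) : ℝ) + 1)| *
          |(-(2 * a) + ((2 * (j + 1) : ℕ) : ℝ)) / (((2 * (j + 1) : ℕ) : ℝ) + 1)| ≤
          |(-s + ((j + 1 : ℕ) : ℝ)) / (((j + 1 : ℕ) : ℝ) + 1)| := by
        push_cast
        have hj : (0 : ℝ) ≤ j := by positivity
        rw [abs_of_nonneg (div_nonneg (by linarith) (by positivity)),
          abs_of_nonneg (div_nonneg (by linarith) (by positivity)),
          abs_of_nonneg (div_nonneg (by linarith) (by positivity))]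
        calc _ = ((2 * ((j : ℝ) + 1) + 1 - 2 * a) / (2 * (j + 1) + 1)) *
              ((j + 1 - a) / (j + 1 + 1)) := by
              rw [div_mul_div_comm, div_mul_div_comm, div_eq_div_iff (by positivity) (by positivity)]
              ring
          _ ≤ 1 * ((j + 1 - s) / (j + 1 + 1)) := by
              gcongr
              · exact div_nonneg (by linarith) (by positivity)
              · rw [div_le_one (by positivity)]; linarith
          _ = _ := by ring
      calc _ = (|(-(2 * a) + ((2 * (j + 1) + 1 : ℕ) : ℝ)) / (((2 * (j + 1) + 1 : ℕ) : ℝ) + 1)| *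
          |(-(2 * a) + ((2 * (j + 1) : ℕ) : ℝ)) / (((2 * (j + 1) : ℕ) : ℝ) + 1)|) *
            (|pochCoeff (-(2 * a)) (2 * (j + 1))| * s) := by ring
        _ ≤ _ := by gcongr

lemma summable_pochCoeff_neg_two_mul {a : ℝ} (ha : 0 < a) (ha1 : a ≤ 1) :
    Summable fun j => pochCoeff (-(2 * a)) (2 * j) := by
  refine Summable.of_norm_bounded ((summable_abs_pochCoeff_neg (half_pos ha)
    (by linarith)).div_const (a / 2)) fun j => ?_
  exact abs_pochCoeff_neg_two_mul_le (half_pos ha) (by linarith) ha1 (by linarith) j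

lemma tendsto_sq_nhdsLT_one : Tendsto (fun x : ℝ => x ^ 2) (𝓝[<] 1) (𝓝[<] 1) := by
  refine tendsto_nhdsWithin_iff.2 ⟨?_, ?_⟩
  · have : ContinuousAt (fun x : ℝ => x ^ 2) 1 := by fun_prop
    simpa [ContinuousAt] using this.tendsto.mono_left nhdsWithin_le_nhds
  · filter_upwards [Ioo_mem_nhdsLT (show (0 : ℝ) < 1 by norm_num)] with x hx
    have := hx.1; have := hx.2
    simp only [Set.mem_Iio]; nlinarith

/-- The even part of (1-x)^{2a} is ((1-x)^{2a} + (1+x)^{2a})/2. Abel's theorem in the variable x²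
evaluates it at x = 1, where the first power vanishes because a > 0. -/
lemma tsum_pochCoeff_neg_two_mul {a : ℝ} (ha : 0 < a) (ha1 : a ≤ 1) :
    ∑' j, pochCoeff (-(2 * a)) (2 * j) = 4 ^ a / 2 := by
  have hs : Summable fun j => (pochCoeff (-(2 * a)) (2 * j) : ℂ) := by
    exact_mod_cast Complex.hasSum_ofReal.2 (summable_pochCoeff_neg_two_mul ha ha1).hasSum |>.summable
  have h1 := Complex.tendsto_tsum_powerSeries_nhdsWithin_lt hs.hasSum.tendsto_sum_nat
  rw [tendsto_map'_iff] at h1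
  have h2 := h1.comp tendsto_sq_nhdsLT_one
  have h3 : Tendsto (fun x : ℝ => ((((1 - x : ℝ) ^ (2 * a) : ℝ) : ℂ) +
      (((1 + x : ℝ) ^ (2 * a) : ℝ) : ℂ)) / 2) (𝓝[<] 1)
      (𝓝 (((((1 - 1 : ℝ) ^ (2 * a) : ℝ) : ℂ) + (((1 + 1 : ℝ) ^ (2 * a) : ℝ) : ℂ)) / 2)) := by
    refine Tendsto.mono_left ?_ nhdsWithin_le_nhds
    have : ContinuousAt (fun x : ℝ => ((((1 - x : ℝ) ^ (2 * a) : ℝ) : ℂ) +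
      (((1 + x : ℝ) ^ (2 * a) : ℝ) : ℂ)) / 2) 1 := by
      refine ContinuousAt.div_const (ContinuousAt.add ?_ ?_) _
      · refine Complex.continuous_ofReal.continuousAt.comp ?_
        exact (by fun_prop : ContinuousAt (fun x : ℝ => 1 - x) 1).rpow_const
          (Or.inr (by positivity))
      · refine Complex.continuous_ofReal.continuousAt.comp ?_
        exact (by fun_prop : ContinuousAt (fun x : ℝ => 1 + x) 1).rpow_const
          (Or.inr (by positivity))
    exact this.tendsto
  have h4 : (fun x : ℝ => ((((1 - x : ℝ) ^ (2 * a) : ℝ) : ℂ) +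
      (((1 + x : ℝ) ^ (2 * a) : ℝ) : ℂ)) / 2) =ᶠ[𝓝[<] 1]
      ((fun z : ℂ => ∑' n, (pochCoeff (-(2 * a)) (2 * n) : ℂ) * z ^ n) ∘ Complex.ofReal) ∘
        fun x : ℝ => x ^ 2 := by
    filter_upwards [Ioo_mem_nhdsLT (show (0 : ℝ) < 1 by norm_num)] with x hx
    have hx1 : ‖(x : ℂ)‖ < 1 := by
      rw [Complex.norm_real, Real.norm_eq_abs, abs_of_pos hx.1]; exact hx.2
    have hA := hasSum_pochCoeff (-(2 * a)) hx1
    have hB := hasSum_pochCoeff (-(2 * a)) (x := -x) (by rwa [norm_neg])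
    have hC := (hasSum_even_part hA hB).tsum_eq
    simp only [Function.comp_apply]
    push_cast
    simp only [← pow_mul]
    rw [hC, Complex.ofReal_cpow (by linarith [hx.2]), Complex.ofReal_cpow (by linarith [hx.1])]
    push_cast
    simp
  have h5 := tendsto_nhds_unique (h3.congr' h4) h2
  rw [← Complex.ofReal_tsum] at h5
  rw [sub_self, Real.zero_rpow (by positivity)] at h5
  have h6 : ((1 + 1 : ℝ)) ^ (2 * a) = 4 ^ a := by
    rw [Real.rpow_mul (by norm_num)]; norm_num
  rw [h6] at h5
  have h7 : (((4 : ℝ) ^ a / 2 : ℝ) : ℂ) = ((∑' j, pochCoeff (-(2 * a)) (2 * j) : ℝ) : ℂ) := by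
    rw [← h5]; push_cast; simp
  exact_mod_cast h7.symm

lemma pochCoeff_sub_div_le_two {a : ℝ} (ha : 0 < a) {p j : ℕ} (h : 2 * j ≤ p) :
    pochCoeff a (p - j) / pochCoeff a p ≤ 2 := by
  rw [div_le_iff₀ (pochCoeff_pos ha p)]
  rcases Nat.eq_zero_or_pos (p - j) with h0 | h0
  · have : p = 0 := by omega
    subst this; simp
  · have h1 := mul_pochCoeff_mono ha (Nat.sub_le p j)
    have h2 : (p : ℝ) ≤ 2 * ((p - j : ℕ) : ℝ) := by exact_mod_cast (by omega : p ≤ 2 * (p - j))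
    have h3 : (0 : ℝ) < ((p - j : ℕ) : ℝ) := by exact_mod_cast h0
    refine le_of_mul_le_mul_left ?_ h3
    nlinarith [pochCoeff_pos ha p]

lemma tendsto_pochCoeff_sub_div {X : Type*} {l : Filter X} {f : X → ℕ} {g : X → ℝ}
    (hf : Tendsto f l atTop) (hg : ∀ᶠ x in l, g x ∈ Set.Ioc (0 : ℝ) 1) (j : ℕ) :
    Tendsto (fun x => pochCoeff (g x) (f x - j) / pochCoeff (g x) (f x)) l (𝓝 1) := by
  have h1 : Tendsto (fun n : ℕ => ((n + j : ℕ) : ℝ) / n) atTop (𝓝 1) := by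
    have h := (tendsto_natCast_div_add_atTop (j : ℝ)).inv₀ one_ne_zero
    simp only [inv_div, inv_one] at h
    exact_mod_cast h
  have h2 : Tendsto (fun x => (f x : ℝ) / ((f x - j : ℕ) : ℝ)) l (𝓝 1) := by
    refine (h1.comp ((tendsto_sub_atTop_nat j).comp hf)).congr' ?_
    filter_upwards [hf.eventually_ge_atTop j] with x hx
    simp only [Function.comp_apply]
    rw [Nat.sub_add_cancel hx]
  refine tendsto_of_tendsto_of_tendsto_of_le_of_le' tendsto_const_nhds h2 ?_ ?_
  · filter_upwards [hg] with x hx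
    rw [one_le_div (pochCoeff_pos hx.1 _)]
    exact pochCoeff_antitone hx.1.le hx.2 (Nat.sub_le _ _)
  · filter_upwards [hg, hf.eventually_gt_atTop j] with x hx hj
    have h3 : (0 : ℝ) < ((f x - j : ℕ) : ℝ) := by exact_mod_cast Nat.sub_pos_of_lt hj
    rw [div_le_div_iff₀ (pochCoeff_pos hx.1 _) h3, mul_comm]
    exact mul_pochCoeff_mono hx.1 (Nat.sub_le _ _)

/-- For j > p/2 the first factor is at most (2/p) times the coefficient of (1-x)^{s-1} at p/2, up to
a shift of index, while the second factors sum to at most p/a. What is left tends to 0. -/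
lemma sum_tail_le {a s : ℝ} (hs : 0 < s) (hsa : s ≤ a) (ha1 : a ≤ 1) (hs1 : s < 1) (p : ℕ) :
    |∑ j ∈ (Finset.range (p + 1)).filter (fun j => ¬ 2 * j ≤ p),
      pochCoeff (-(2 * a)) (2 * j) * (pochCoeff a (p - j) / pochCoeff a p)| ≤
      2 / s * pochCoeff (1 - s) (p / 2) := by
  have ha : 0 < a := hs.trans_le hsa
  have hD : ∀ j ∈ (Finset.range (p + 1)).filter (fun j => ¬ 2 * j ≤ p),
      |pochCoeff (-(2 * a)) (2 * j) * (pochCoeff a (p - j) / pochCoeff a p)| ≤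
        (2 / p * pochCoeff (1 - s) (p / 2)) * (pochCoeff a (p - j) / pochCoeff a p) := by
    intro j hj
    simp only [Finset.mem_filter, Finset.mem_range, not_le] at hj
    have hp : (0 : ℝ) < p := by exact_mod_cast (by omega : 0 < p)
    rw [abs_mul, abs_of_nonneg (div_nonneg (pochCoeff_pos ha _).le (pochCoeff_pos ha _).le)]
    refine mul_le_mul_of_nonneg_right ?_
      (div_nonneg (pochCoeff_pos ha _).le (pochCoeff_pos ha _).le)
    refine (abs_pochCoeff_neg_two_mul_le hs hsa ha1 hs1 j).trans ?_
    obtain ⟨k, rfl⟩ := Nat.exists_eq_succ_of_ne_zero (by omega : j ≠ 0)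
    have h := succ_mul_pochCoeff_succ (-s) k
    have hk : (0 : ℝ) < (k : ℝ) + 1 := by positivity
    have h0 := pochCoeff_nonneg (s := 1 - s) (by linarith) k
    rw [show -s + 1 = 1 - s by ring] at h
    have h1 : |pochCoeff (-s) (k + 1)| / s = pochCoeff (1 - s) k / (k + 1) := by
      have h2 : pochCoeff (-s) (k + 1) = -(s * (pochCoeff (1 - s) k / (k + 1))) := by
        field_simp
        linear_combination h
      rw [h2, abs_neg, abs_of_nonneg (by positivity), mul_div_cancel_left₀ _ hs.ne']
    rw [Nat.succ_eq_add_one, h1]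
    have h2 : pochCoeff (1 - s) k ≤ pochCoeff (1 - s) (p / 2) :=
      pochCoeff_antitone (by linarith) (by linarith) (by omega)
    have h3 : (p : ℝ) ≤ 2 * (k + 1) := by exact_mod_cast (by omega : p ≤ 2 * (k + 1))
    have h4 := pochCoeff_nonneg (s := 1 - s) (by linarith) (p / 2)
    calc _ ≤ pochCoeff (1 - s) (p / 2) / (p / 2) := by gcongr; linarith
      _ = _ := by field_simp
  refine (Finset.abs_sum_le_sum_abs _ _).trans ((Finset.sum_le_sum hD).trans ?_)
  rw [← Finset.mul_sum, ← Finset.sum_div]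
  rcases Nat.eq_zero_or_pos p with rfl | hp
  · simp; exact div_nonneg zero_le_two hs.le
  have hp' : (0 : ℝ) < p := by exact_mod_cast hp
  have h5 : ∑ j ∈ (Finset.range (p + 1)).filter (fun j => ¬ 2 * j ≤ p), pochCoeff a (p - j) ≤
      p * pochCoeff a p / a := by
    rw [← sum_range_pochCoeff ha.ne', ← Finset.sum_range_reflect]
    have e : ∑ j ∈ Finset.range p, pochCoeff a (p - 1 - j) =
        ∑ j ∈ (Finset.range p).map ⟨Nat.succ, Nat.succ_injective⟩, pochCoeff a (p - j) := by
      rw [Finset.sum_map]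
      refine Finset.sum_congr rfl fun j _ => ?_
      simp [Nat.sub_sub, Nat.add_comm]
    rw [e]
    refine Finset.sum_le_sum_of_subset_of_nonneg ?_ fun _ _ _ => (pochCoeff_pos ha _).le
    intro j hj
    simp only [Finset.mem_filter, Finset.mem_range, not_le] at hj
    simp only [Finset.mem_map, Finset.mem_range, Function.Embedding.coeFn_mk]
    exact ⟨j - 1, by omega, by omega⟩
  have h4 := pochCoeff_nonneg (s := 1 - s) (by linarith) (p / 2)
  have h6 := pochCoeff_pos ha p
  calc _ ≤ 2 / p * pochCoeff (1 - s) (p / 2) * (p * pochCoeff a p / a / pochCoeff a p) := by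
        gcongr
    _ = 2 / a * pochCoeff (1 - s) (p / 2) := by field_simp
    _ ≤ _ := by gcongr

lemma evenCoeff_div_pochCoeff {a : ℝ} (p : ℕ) : evenCoeff a p / pochCoeff a p =
    (∑' j, if 2 * j ≤ p then
      pochCoeff (-(2 * a)) (2 * j) * (pochCoeff a (p - j) / pochCoeff a p) else 0) +
    ∑ j ∈ (Finset.range (p + 1)).filter (fun j => ¬ 2 * j ≤ p),
      pochCoeff (-(2 * a)) (2 * j) * (pochCoeff a (p - j) / pochCoeff a p) := by
  rw [tsum_eq_sum (s := Finset.range (p + 1)), ← Finset.sum_filter,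
    Finset.sum_filter_add_sum_filter_not, evenCoeff_eq_sum,
    Finset.Nat.sum_antidiagonal_eq_sum_range_succ_mk, Finset.sum_div]
  · exact Finset.sum_congr rfl fun j _ => by ring
  · intro j hj
    simp only [Finset.mem_range, not_lt] at hj
    rw [if_neg (by omega)]

/-- Dominated convergence on the indices j ≤ p/2, where the ratios are at most 2, and `sum_tail_le`
on the others. -/
lemma tendsto_evenCoeff_div_pochCoeff {X : Type*} {l : Filter X} {f : X → ℕ} {g : X → ℝ}
    (hf : Tendsto f l atTop) (hg : ∀ᶠ x in l, g x ∈ Set.Ioc (0 : ℝ) 1) {a : ℝ}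
    (ha : a ∈ Set.Ioc (0 : ℝ) 1) (hga : Tendsto g l (𝓝 a)) :
    Tendsto (fun x => evenCoeff (g x) (f x) / pochCoeff (g x) (f x)) l (𝓝 (4 ^ a / 2)) := by
  have hs : 0 < a / 2 := half_pos ha.1
  have hs1 : a / 2 < 1 := by linarith [ha.2]
  have hsa : ∀ᶠ x in l, a / 2 ≤ g x := hga.eventually_const_le (by linarith [ha.1])
  simp only [evenCoeff_div_pochCoeff]
  rw [← add_zero (4 ^ a / 2), ← tsum_pochCoeff_neg_two_mul ha.1 ha.2]
  refine Tendsto.add ?_ ?_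
  · refine tendsto_tsum_of_dominated_convergence
      (bound := fun j => |pochCoeff (-(a / 2)) j| / (a / 2) * 2)
      (((summable_abs_pochCoeff_neg hs hs1).div_const _).mul_right _) (fun j => ?_) ?_
    · have h1 := (((continuous_pochCoeff (2 * j)).comp
        (continuous_const.mul continuous_id : Continuous fun x : ℝ => 2 * x).neg).tendsto a).comp hga
      have h2 := h1.mul (tendsto_pochCoeff_sub_div hf hg j)
      rw [mul_one] at h2
      refine h2.congr' ?_
      filter_upwards [hf.eventually_ge_atTop (2 * j)] with x hx
      rw [if_pos hx]; rfl
    · filter_upwards [hg, hsa] with x hx hx2 j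
      split_ifs with h
      · rw [norm_mul]
        have h0 : 0 ≤ pochCoeff (g x) (f x - j) / pochCoeff (g x) (f x) :=
          div_nonneg (pochCoeff_pos hx.1 _).le (pochCoeff_pos hx.1 _).le
        refine mul_le_mul (abs_pochCoeff_neg_two_mul_le hs hx2 hx.2 hs1 j) ?_ (norm_nonneg _)
          (by positivity)
        rw [Real.norm_of_nonneg h0]
        exact pochCoeff_sub_div_le_two hx.1 h
      · rw [norm_zero]; positivity
  · have h1 : Tendsto (fun x => 2 / (a / 2) * pochCoeff (1 - a / 2) (f x / 2)) l (𝓝 0) := by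
      have h2 := (tendsto_pochCoeff_atTop_zero (s := 1 - a / 2) (by linarith) (by linarith)).comp
        ((Nat.tendsto_div_const_atTop two_ne_zero).comp hf)
      simpa using h2.const_mul (2 / (a / 2))
    refine squeeze_zero_norm' ?_ h1
    filter_upwards [hg, hsa] with x hx hx2
    exact sum_tail_le hs hx2 hx.2 hs1 (f x)

/-- Euler's reflection formula, with sin(πb) = √(1-q²). The right side is regular at q = 1 and is
the constant that the coefficient asymptotics produce. -/
lemma one_add_mul_rConst {q : ℝ} (h : -1 < q) (h1 : q ≤ 1) :
    (1 + q) * rConst q = 4 ^ (1 - bExp q) / 2 / Real.Gamma (1 - bExp q) := by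
  rcases h1.eq_or_lt with rfl | h1
  · rw [rConst, if_pos rfl, bExp_one]; norm_num
  · have hb := bExp_pos h1
    have hb1 := bExp_lt_one h
    have hG := Real.Gamma_mul_Gamma_one_sub (bExp q)
    have hG1 := Real.Gamma_pos_of_pos (sub_pos.2 hb1)
    have hsin : Real.sin (Real.pi * bExp q) = √(1 - q ^ 2) := by
      rw [bExp, mul_div_cancel₀ _ Real.pi_ne_zero, Real.sin_arccos]
    have hq : 0 < 1 + q := by linarith
    have hs : 0 < √(1 - q ^ 2) := Real.sqrt_pos.2 (by nlinarith)
    have hsq : (1 + q) * √((1 - q) / (1 + q)) = √(1 - q ^ 2) := by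
      have h2 : 1 - q ^ 2 = (1 + q) ^ 2 * ((1 - q) / (1 + q)) := by field_simp; ring
      rw [h2, Real.sqrt_mul (sq_nonneg _), Real.sqrt_sq hq.le]
    rw [hsin] at hG
    have h4 : (4 : ℝ) ^ (1 - bExp q) = 4 * 4 ^ (-bExp q) := by
      rw [sub_eq_add_neg, Real.rpow_add (by norm_num), Real.rpow_one]
    rw [rConst, if_neg h1.ne, eq_div_iff hG1.ne', h4]
    have hpi := Real.pi_pos.ne'
    calc _ = 2 * (4 ^ (-bExp q) / Real.pi) * ((1 + q) * √((1 - q) / (1 + q))) *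
          (Real.Gamma (bExp q) * Real.Gamma (1 - bExp q)) := by ring
      _ = _ := by rw [hsq, hG]; field_simp; ring

lemma rConst_pos {q : ℝ} (h : -1 < q) (h1 : q ≤ 1) : 0 < rConst q := by
  have h2 := one_add_mul_rConst h h1
  have hG := Real.Gamma_pos_of_pos (sub_pos.2 (bExp_lt_one h))
  have h3 : 0 < (1 + q) * rConst q := by rw [h2]; positivity
  exact pos_of_mul_pos_right h3 (by linarith)

lemma tendsto_hDown_div {X : Type*} {l : Filter X} {f : X → ℕ} {g : X → ℝ}
    (hf : Tendsto f l atTop) (hg : ∀ᶠ x in l, g x ∈ Set.Ioc (-1 : ℝ) 1) {q : ℝ}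
    (hq : q ∈ Set.Ioc (-1 : ℝ) 1) (hgq : Tendsto g l (𝓝 q)) :
    Tendsto (fun x => hDown (g x) (f x) / (rConst (g x) * (f x : ℝ) ^ (-bExp (g x)))) l (𝓝 1) := by
  have ha : ∀ q ∈ Set.Ioc (-1 : ℝ) 1, 1 - bExp q ∈ Set.Ioc (0 : ℝ) 1 := fun q hq =>
    ⟨sub_pos.2 (bExp_lt_one hq.1), by linarith [bExp_nonneg q]⟩
  have hg' : ∀ᶠ x in l, 1 - bExp (g x) ∈ Set.Ioc (0 : ℝ) 1 := hg.mono fun x hx => ha _ hx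
  have hga : Tendsto (fun x => 1 - bExp (g x)) l (𝓝 (1 - bExp q)) :=
    tendsto_const_nhds.sub ((continuous_bExp.tendsto q).comp hgq)
  have h1 := tendsto_evenCoeff_div_pochCoeff hf hg' (ha q hq) hga
  have h2 := tendsto_Gamma_mul_pochCoeff_mul_rpow hf hg'
  have h3 : Tendsto (fun x => (4 : ℝ) ^ (1 - bExp (g x)) / 2) l (𝓝 (4 ^ (1 - bExp q) / 2)) :=
    (tendsto_const_nhds.rpow hga (Or.inl (by norm_num))).div_const 2
  have h4 := (h1.div h3 (by positivity)).mul h2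
  rw [div_self (by positivity), one_mul] at h4
  refine h4.congr' ?_
  filter_upwards [hg, hf.eventually_gt_atTop 0] with x hx hp
  have hp' : (0 : ℝ) < f x := by exact_mod_cast hp
  have h5 := one_add_mul_rConst hx.1 hx.2
  have hG := Real.Gamma_pos_of_pos (sub_pos.2 (bExp_lt_one hx.1))
  have hP := pochCoeff_pos (sub_pos.2 (bExp_lt_one hx.1)) (f x)
  have h1q : 0 < 1 + g x := by linarith [hx.1]
  have hr := rConst_pos hx.1 hx.2
  have h44 : (0 : ℝ) < 4 ^ (1 - bExp (g x)) := by positivity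
  have h6 : (4 : ℝ) ^ (1 - bExp (g x)) = 2 * Real.Gamma (1 - bExp (g x)) * ((1 + g x) * rConst (g x)) := by
    rw [h5]; field_simp
  rw [hDown_eq_evenCoeff hx.1 hx.2 hp.ne', sub_sub_cancel, Real.rpow_neg hp'.le]
  have hpb : 0 < (f x : ℝ) ^ bExp (g x) := by positivity
  simp only [Pi.div_apply]
  rw [h6]
  field_simp

lemma isEquivalent_hDown {q : ℝ} (hq : q ∈ Set.Ioc (-1 : ℝ) 1) :
    (fun p : ℕ => hDown q p) ~[atTop] fun p : ℕ => rConst q * (p : ℝ) ^ (-bExp q) := by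
  rw [isEquivalent_iff_tendsto_one]
  · exact tendsto_hDown_div (f := id) (g := fun _ => q) tendsto_id
      (Eventually.of_forall fun _ => hq) hq tendsto_const_nhds
  · filter_upwards [eventually_gt_atTop 0] with p hp
    have hp' : (0 : ℝ) < p := by exact_mod_cast hp
    have := rConst_pos hq.1 hq.2
    positivity

/-- On a compact set, uniform convergence to a constant follows from joint convergence as p → ∞ and
the parameter tends to any point of the set. This is why the preceding asymptotics let both vary
along a filter. -/
lemma tendstoUniformlyOn_hDown {a c : ℝ} (ha : -1 < a) (hc : c ≤ 1) :
    TendstoUniformlyOn (fun (p : ℕ) (q : ℝ) => hDown q p / (rConst q * (p : ℝ) ^ (-bExp q)))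
      (fun _ => 1) atTop (Set.Icc a c) := by
  rw [← tendstoLocallyUniformlyOn_iff_tendstoUniformlyOn_of_compact isCompact_Icc,
    tendstoLocallyUniformlyOn_iff_forall_tendsto]
  intro q hq
  rw [← Uniform.tendsto_nhds_right]
  refine tendsto_hDown_div tendsto_fst ?_ (q := q) ⟨ha.trans_le hq.1, hq.2.trans hc⟩
    (tendsto_snd.mono_right nhdsWithin_le_nhds)
  have : ∀ᶠ x in 𝓝[Set.Icc a c] q, x ∈ Set.Ioc (-1 : ℝ) 1 := by
    filter_upwards [self_mem_nhdsWithin] with x hx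
    exact ⟨ha.trans_le hx.1, hx.2.trans hc⟩
  exact tendsto_snd.eventually this

lemma tendsto_hDown_atTop_zero {q : ℝ} (h : -1 < q) (h1 : q < 1) :
    Tendsto (fun p : ℕ => hDown q p) atTop (𝓝 0) := by
  refine (isEquivalent_hDown ⟨h, h1.le⟩).symm.tendsto_nhds ?_
  have := (tendsto_rpow_neg_atTop (bExp_pos h1)).comp (tendsto_natCast_atTop_atTop (R := ℝ))
  simpa using this.const_mul (rConst q)

/-! ### The generating function on the closed disc -/

lemma log_div_of_re_pos {z w : ℂ} (hz : 0 < z.re) (hw : 0 < w.re) :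
    Complex.log (z / w) = Complex.log z - Complex.log w := by
  have hz0 : z ≠ 0 := by rintro rfl; simp at hz
  have hw0 : w ≠ 0 := by rintro rfl; simp at hw
  have h1 := abs_lt.1 (Complex.abs_arg_lt_pi_div_two_iff.2 (Or.inl hz))
  have h2 := abs_lt.1 (Complex.abs_arg_lt_pi_div_two_iff.2 (Or.inl hw))
  rw [← Complex.log_exp (x := Complex.log z - Complex.log w), Complex.exp_sub, Complex.exp_log hz0,
    Complex.exp_log hw0]
  · rw [Complex.sub_im, Complex.log_im, Complex.log_im]; linarith
  · rw [Complex.sub_im, Complex.log_im, Complex.log_im]; linarith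

lemma re_one_add_pos {x : ℂ} (hx : ‖x‖ < 1) : 0 < (1 + x).re := by
  have := (abs_lt.1 ((Complex.abs_re_le_norm x).trans_lt hx)).1
  simp only [Complex.add_re, Complex.one_re]; linarith

lemma re_one_sub_pos {x : ℂ} (hx : ‖x‖ < 1) : 0 < (1 - x).re := by
  simpa [sub_eq_add_neg] using re_one_add_pos (x := -x) (by rwa [norm_neg])

lemma cartanh_eq {x : ℂ} (hx : ‖x‖ < 1) :
    cartanh x = (Complex.log (1 + x) - Complex.log (1 - x)) / 2 := by
  rw [cartanh, log_div_of_re_pos (re_one_add_pos hx) (re_one_sub_pos hx)]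

lemma cartanh_neg {x : ℂ} (hx : ‖x‖ < 1) : cartanh (-x) = -cartanh x := by
  rw [cartanh_eq hx, cartanh_eq (by rwa [norm_neg])]
  simp only [sub_neg_eq_add, ← sub_eq_add_neg]
  ring

lemma hasSum_cayleyCoeff (a : ℝ) {x : ℂ} (hx : ‖x‖ < 1) :
    HasSum (fun n => (cayleyCoeff a n : ℂ) * x ^ n) (Complex.exp (2 * a * cartanh x)) := by
  have h1 := hasSum_pochCoeff (-a) (x := -x) (by rwa [norm_neg])
  have h2 := hasSum_pochCoeff a hx
  have h3 := summable_norm_sum_mul_antidiagonal_of_summable_norm h1.summable.norm h2.summable.norm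
  have h4 := tsum_mul_tsum_eq_tsum_sum_antidiagonal_of_summable_norm h1.summable.norm
    h2.summable.norm
  have h5 : ∀ n, ∑ kl ∈ Finset.HasAntidiagonal.antidiagonal n,
      (pochCoeff (-a) kl.1 : ℂ) * (-x) ^ kl.1 * ((pochCoeff a kl.2 : ℂ) * x ^ kl.2) =
      (cayleyCoeff a n : ℂ) * x ^ n := by
    intro n
    rw [cayleyCoeff_eq_sum, Complex.ofReal_sum, Finset.sum_mul]
    refine Finset.sum_congr rfl fun kl hkl => ?_
    rw [← Finset.HasAntidiagonal.mem_antidiagonal.1 hkl, pow_add, neg_pow x]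
    push_cast
    ring
  simp only [h5] at h3 h4
  rw [h1.tsum_eq, h2.tsum_eq] at h4
  have h6 := h3.of_norm.hasSum
  rw [← h4] at h6
  have hA : 1 + x ≠ 0 := fun h => by simpa [h] using re_one_add_pos hx
  have hB : 1 - x ≠ 0 := fun h => by simpa [h] using re_one_sub_pos hx
  have h7 : (1 - -x) ^ (-((-a : ℝ) : ℂ)) * (1 - x) ^ (-a : ℂ) = Complex.exp (2 * a * cartanh x) := by
    rw [sub_neg_eq_add, Complex.cpow_def_of_ne_zero hA, Complex.cpow_def_of_ne_zero hB,
      ← Complex.exp_add, cartanh_eq hx]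
    congr 1
    push_cast
    ring
  rwa [h7] at h6

lemma hasSum_evenCoeff (a : ℝ) {x : ℂ} (hx : ‖x‖ < 1) :
    HasSum (fun p => (evenCoeff a p : ℂ) * x ^ (2 * p)) (Complex.cosh (2 * a * cartanh x)) := by
  have h := hasSum_even_part (f := fun n => (cayleyCoeff a n : ℂ)) (hasSum_cayleyCoeff a hx)
    (hasSum_cayleyCoeff a (x := -x) (by rwa [norm_neg]))
  rw [cartanh_neg hx, mul_neg] at h
  exact h

/-- The generating function of `hDown q`, as a function of the square root of the variable. -/
def hDownGenFun (q : ℝ) (x : ℂ) : ℂ :=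
  1 / (1 + (q : ℂ)) * ((q : ℂ) + Complex.cosh (2 * ((bExp q : ℂ) - 1) * cartanh x))

lemma hasSum_hDown {q : ℝ} (h : -1 < q) (h1 : q ≤ 1) {x : ℂ} (hx : ‖x‖ < 1) :
    HasSum (fun p => (hDown q p : ℂ) * x ^ (2 * p)) (hDownGenFun q x) := by
  have hq : (1 + q : ℂ) ≠ 0 := by exact_mod_cast (by linarith : 1 + q ≠ 0)
  have h2 := (((hasSum_ite_eq (0 : ℕ) (q : ℂ)).add (hasSum_evenCoeff (1 - bExp q) hx)).mul_left
    (1 / (1 + (q : ℂ))))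
  have h3 : Complex.cosh (2 * ((bExp q : ℂ) - 1) * cartanh x) =
      Complex.cosh (2 * ((1 - bExp q : ℝ) : ℂ) * cartanh x) := by
    rw [← Complex.cosh_neg]; congr 1; push_cast; ring
  rw [hDownGenFun, h3]
  refine (funext fun p => ?_ : (fun p => (hDown q p : ℂ) * x ^ (2 * p)) = _) ▸ h2
  rcases p with _ | p
  · simp
    field_simp
    ring
  · rw [hDown_eq_evenCoeff h h1 p.succ_ne_zero, if_neg p.succ_ne_zero]
    push_cast
    field_simp
    ring

lemma hDown_succ_antitone {q : ℝ} (h : -1 < q) (h1 : q ≤ 1) :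
    Antitone fun p => hDown q (p + 1) := by
  intro m n hmn
  simp only [hDown_eq_evenCoeff h h1 (Nat.succ_ne_zero _)]
  have := antitone_evenCoeff (sub_pos.2 (bExp_lt_one h)) (by linarith [bExp_nonneg q]) hmn
  exact div_le_div_of_nonneg_right this (by linarith)

/-- Dirichlet's test: the coefficients decrease to 0 from index 1 on, and the geometric sums in x²
are bounded since x² ≠ 1. -/
lemma exists_tendsto_sum_hDown {q : ℝ} (h : -1 < q) (h1 : q < 1) {x : ℂ} (hx : ‖x‖ = 1)
    (hx1 : x ≠ 1) (hx2 : x ≠ -1) :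
    ∃ l, Tendsto (fun n : ℕ => ∑ p ∈ Finset.range n, (hDown q p : ℂ) * x ^ (2 * p)) atTop (𝓝 l) := by
  have hz : x ^ 2 ≠ 1 := fun h => by
    rcases sq_eq_one_iff.1 h with h | h <;> contradiction
  have hbd : ∀ n, ‖∑ i ∈ Finset.range n, x ^ (2 * (i + 1))‖ ≤ 2 / ‖x ^ 2 - 1‖ := by
    intro n
    have h2 : ∑ i ∈ Finset.range n, x ^ (2 * (i + 1)) = x ^ 2 * (((x ^ 2) ^ n - 1) / (x ^ 2 - 1)) := by
      rw [← geom_sum_eq hz, Finset.mul_sum]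
      exact Finset.sum_congr rfl fun i _ => by ring
    rw [h2, norm_mul, norm_div, norm_pow, hx, one_pow, one_mul]
    gcongr
    refine (norm_sub_le _ _).trans ?_
    rw [norm_pow, norm_pow, hx]; norm_num
  have hc := Antitone.cauchySeq_series_mul_of_tendsto_zero_of_bounded (hDown_succ_antitone h h1.le)
    ((tendsto_add_atTop_iff_nat 1).2 (tendsto_hDown_atTop_zero h h1)) hbd
  obtain ⟨l, hl⟩ := cauchySeq_tendsto_of_complete hc
  refine ⟨l + 1, ?_⟩
  rw [← tendsto_add_atTop_iff_nat 1]
  refine (hl.add_const 1).congr fun n => ?_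
  rw [Finset.sum_range_succ']
  simp

/-- On the unit circle away from ±1 the quotient (1+x)/(1-x) has nonzero imaginary part, so it
avoids the cut of the logarithm. -/
lemma continuousAt_hDownGenFun (q : ℝ) {x : ℂ} (hx : ‖x‖ = 1) (hx1 : x ≠ 1) (hx2 : x ≠ -1) :
    ContinuousAt (hDownGenFun q) x := by
  have h1x : 1 - x ≠ 0 := fun h => hx1 (sub_eq_zero.1 h).symm
  have hmem : (1 + x) / (1 - x) ∈ Complex.slitPlane := by
    refine Or.inr ?_
    have hn : Complex.normSq x = 1 := by rw [Complex.normSq_eq_norm_sq, hx, one_pow]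
    have him : x.im ≠ 0 := by
      intro him
      rw [Complex.normSq_apply, him] at hn
      have hre : x.re = 1 ∨ x.re = -1 := by
        exact sq_eq_one_iff.1 (by nlinarith)
      rcases hre with hre | hre
      · exact hx1 (Complex.ext hre him)
      · exact hx2 (Complex.ext (by simpa using hre) (by simpa using him))
    have : ((1 + x) / (1 - x)).im = 2 * x.im / Complex.normSq (1 - x) := by
      rw [Complex.div_im]; simp; ring
    rw [this]
    exact div_ne_zero (mul_ne_zero two_ne_zero him) (Complex.normSq_pos.2 h1x).ne'
  have hc : ContinuousAt cartanh x := by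
    unfold cartanh
    have hd : ContinuousAt (fun x : ℂ => (1 + x) / (1 - x)) x :=
      (by fun_prop : ContinuousAt (fun x : ℂ => 1 + x) x).div (by fun_prop) h1x
    exact (hd.clog hmem).div_const 2
  have hcosh : ContinuousAt (fun x => Complex.cosh (2 * ((bExp q : ℂ) - 1) * cartanh x)) x :=
    Complex.continuous_cosh.continuousAt.comp (continuousAt_const.mul hc)
  exact continuousAt_const.mul (continuousAt_const.add hcosh)

theorem tendsto_sum_hDown {q : ℝ} (hq : q ∈ Set.Ioo (-1 : ℝ) 1) {x : ℂ} (hx : ‖x‖ ≤ 1) (hx1 : x ≠ 1)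
    (hx2 : x ≠ -1) :
    Tendsto (fun n : ℕ => ∑ p ∈ Finset.range n, (hDown q p : ℂ) * x ^ (2 * p)) atTop
      (𝓝 (hDownGenFun q x)) := by
  rcases hx.lt_or_eq with hx | hx
  · exact (hasSum_hDown hq.1 hq.2.le hx).tendsto_sum_nat
  · obtain ⟨l, hl⟩ := exists_tendsto_sum_hDown hq.1 hq.2 hx hx1 hx2
    -- Abel's theorem for the coefficients h(p)x^{2p}, with t² as variable, identifies the
    -- conditional sum with the radial limit of the generating function.
    have h1 := Complex.tendsto_tsum_powerSeries_nhdsWithin_lt hl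
    rw [tendsto_map'_iff] at h1
    have h2 := h1.comp tendsto_sq_nhdsLT_one
    have h3 : Tendsto (fun t : ℝ => hDownGenFun q (t * x)) (𝓝[<] 1) (𝓝 (hDownGenFun q x)) := by
      have hc := continuousAt_hDownGenFun q hx hx1 hx2
      have ht : Tendsto (fun t : ℝ => (t : ℂ) * x) (𝓝[<] 1) (𝓝 x) := by
        have : ContinuousAt (fun t : ℝ => (t : ℂ) * x) 1 := by fun_prop
        simpa [ContinuousAt] using this.tendsto.mono_left nhdsWithin_le_nhds
      exact hc.tendsto.comp ht
    rw [← tendsto_nhds_unique (h3.congr' ?_) h2] at hl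
    · exact hl
    · filter_upwards [Ioo_mem_nhdsLT (show (0 : ℝ) < 1 by norm_num)] with t ht
      have htx : ‖(t : ℂ) * x‖ < 1 := by
        rw [norm_mul, hx, mul_one, Complex.norm_real, Real.norm_eq_abs, abs_of_pos ht.1]; exact ht.2
      rw [← (hasSum_hDown hq.1 hq.2.le htx).tsum_eq]
      simp only [Function.comp_apply]
      refine tsum_congr fun p => ?_
      push_cast
      ring

/-! ### The exit kernel and its explicit images -/

lemma sum_range_pochCoeff_div {s : ℝ} (hs1 : s < 1) (n : ℕ) :
    ∑ l ∈ Finset.range n, pochCoeff s l / (l + 1) = (1 - pochCoeff s n) / (1 - s) := by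
  have h : 1 - s ≠ 0 := by linarith
  induction n with
  | zero => simp
  | succ n ih =>
    have hn : (n : ℝ) + 1 ≠ 0 := by positivity
    rw [Finset.sum_range_succ, ih, pochCoeff_succ]
    field_simp
    ring

lemma sum_range_pochCoeff_mul_sub (s : ℝ) (p n : ℕ) :
    ∑ l ∈ Finset.range n, pochCoeff s l * ((p + 2 - s) / (p + 2 + l) - (p + 1) / (p + 1 + l)) =
      -(pochCoeff s n * (n / (p + 1 + n))) := by
  induction n with
  | zero => simp
  | succ n ih =>
    have hn : (n : ℝ) + 1 ≠ 0 := by positivity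
    have h1 : (p : ℝ) + 1 + n ≠ 0 := by positivity
    have h2 : (p : ℝ) + 2 + n ≠ 0 := by positivity
    have h3 : (p : ℝ) + 1 + (n + 1) ≠ 0 := by positivity
    rw [Finset.sum_range_succ, ih, pochCoeff_succ]
    push_cast
    field_simp
    ring

/-- This is the Beta integral of (p+1) x^p (1-x)^{-s} over [0,1]. The induction on p uses a
telescoping identity for the partial sums instead of integrating. -/
lemma hasSum_pochCoeff_mul_div {s : ℝ} (hs : 0 ≤ s) (hs1 : s < 1) (p : ℕ) :
    HasSum (fun l : ℕ => ((p : ℝ) + 1) / (p + 1 + l) * pochCoeff s l)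
      (1 / pochCoeff (1 - s) (p + 1)) := by
  have h0 := pochCoeff_nonneg hs
  rw [hasSum_iff_tendsto_nat_of_nonneg fun l => mul_nonneg (by positivity) (h0 l)]
  have hlim := tendsto_pochCoeff_atTop_zero hs hs1
  induction p with
  | zero =>
    have h2 := ((tendsto_const_nhds (x := (1 : ℝ))).sub hlim).div_const (1 - s)
    rw [sub_zero] at h2
    rw [zero_add, pochCoeff_one]
    refine h2.congr fun n => ?_
    rw [← sum_range_pochCoeff_div hs1]
    refine Finset.sum_congr rfl fun l _ => ?_
    push_cast
    ring
  | succ p ih =>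
    have hps : (p : ℝ) + 2 - s ≠ 0 := by have : (0 : ℝ) ≤ p := by positivity
                                         linarith
    have h3 : Tendsto (fun n : ℕ => -(pochCoeff s n * ((n : ℝ) / (p + 1 + n)))) atTop (𝓝 0) := by
      refine squeeze_zero_norm (fun n => ?_) hlim
      rw [norm_neg, norm_mul, Real.norm_of_nonneg (h0 n), Real.norm_of_nonneg (by positivity)]
      refine mul_le_of_le_one_right (h0 n) ?_
      rw [div_le_one (by positivity)]
      linarith [(Nat.cast_nonneg p : (0 : ℝ) ≤ p)]
    have h4 := (ih.add h3).mul_const (((p : ℝ) + 2) / (p + 2 - s))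
    have h5 : (1 / pochCoeff (1 - s) (p + 1) + 0) * (((p : ℝ) + 2) / (p + 2 - s)) =
        1 / pochCoeff (1 - s) (p + 1 + 1) := by
      rw [pochCoeff_succ _ (p + 1)]
      have h6 := (pochCoeff_pos (sub_pos.2 hs1) (p + 1)).ne'
      have h7 : (1 - s) + ((p + 1 : ℕ) : ℝ) ≠ 0 := by
        push_cast; intro h; apply hps; linarith
      have h8 : ((p + 1 : ℕ) : ℝ) + 1 ≠ 0 := by positivity
      field_simp
      push_cast
      ring
    rw [h5] at h4
    refine h4.congr fun n => ?_
    rw [← sum_range_pochCoeff_mul_sub, ← Finset.sum_add_distrib, Finset.sum_mul]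
    refine Finset.sum_congr rfl fun l _ => ?_
    have h1 : (p : ℝ) + 1 + l ≠ 0 := by positivity
    have h2 : (p : ℝ) + 2 + l ≠ 0 := by positivity
    have h3 : (p : ℝ) + 1 + 1 + l ≠ 0 := by positivity
    push_cast
    field_simp
    ring

/-- The probability that a walk with admissible law started at `p ≥ 1` first leaves the positive
integers at `-l`. -/
def exitKernel (p l : ℕ) : ℝ := p / (p + l) * (pochCoeff (1 / 2) p * pochCoeff (1 / 2) l)

lemma exitKernel_nonneg (p l : ℕ) : 0 ≤ exitKernel p l :=
  mul_nonneg (by positivity)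
    (mul_nonneg (pochCoeff_nonneg (by norm_num) p) (pochCoeff_nonneg (by norm_num) l))

lemma exitKernel_zero_right {p : ℕ} (hp : p ≠ 0) : exitKernel p 0 = pochCoeff (1 / 2) p := by
  have : (p : ℝ) ≠ 0 := by exact_mod_cast hp
  rw [exitKernel]; simp [this]

lemma exitKernel_le (p l : ℕ) : exitKernel p l ≤ pochCoeff (1 / 2) p := by
  have h1 := pochCoeff_nonneg (s := 1 / 2) (by norm_num) p
  have h2 := pochCoeff_nonneg (s := 1 / 2) (by norm_num) l
  have h3 : pochCoeff (1 / 2) l ≤ 1 := by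
    simpa using pochCoeff_antitone (s := 1 / 2) (by norm_num) (by norm_num) (Nat.zero_le l)
  have h4 : (p : ℝ) / (p + l) ≤ 1 := div_le_one_of_le₀ (by linarith [(Nat.cast_nonneg l : (0 : ℝ) ≤ l)])
    (by positivity)
  calc exitKernel p l ≤ 1 * (pochCoeff (1 / 2) p * 1) := by unfold exitKernel; gcongr
    _ = _ := by ring

/-- Explicit pairs for the exit operator: s = 1/2 gives total mass 1, and s = 1/2 - b gives test
sequences of order p^{-b}. -/
lemma hasSum_exitKernel_mul {s : ℝ} (hs : 0 ≤ s) (hs1 : s < 1) {p : ℕ} (hp : p ≠ 0) :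
    HasSum (fun l => exitKernel p l * (pochCoeff s l / pochCoeff (1 / 2) l))
      (pochCoeff (1 / 2) p / pochCoeff (1 - s) p) := by
  obtain ⟨p, rfl⟩ := Nat.exists_eq_succ_of_ne_zero hp
  have h := (hasSum_pochCoeff_mul_div hs hs1 p).mul_left (pochCoeff (1 / 2) (p + 1))
  rw [mul_one_div] at h
  refine (funext fun l => ?_ : (fun l => exitKernel (p + 1) l *
    (pochCoeff s l / pochCoeff (1 / 2) l)) = _) ▸ h
  have := (pochCoeff_pos (s := 1 / 2) (by norm_num) l).ne'
  rw [exitKernel]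
  push_cast
  field_simp

lemma hasSum_exitKernel {p : ℕ} (hp : p ≠ 0) : HasSum (exitKernel p) 1 := by
  have h := hasSum_exitKernel_mul (s := 1 / 2) (by norm_num) (by norm_num) hp
  have h1 : ∀ l, pochCoeff (1 / 2) l ≠ 0 := fun l => (pochCoeff_pos (by norm_num) l).ne'
  norm_num [h1] at h
  exact h

lemma summable_exitKernel_mul (p : ℕ) {f : ℕ → ℝ} {C : ℝ} (hf : ∀ l, |f l| ≤ C) :
    Summable fun l => exitKernel p l * f l := by
  rcases eq_or_ne p 0 with rfl | hp
  · simp [exitKernel, summable_zero]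
  · refine Summable.of_norm_bounded ((hasSum_exitKernel hp).summable.mul_right C) fun l => ?_
    rw [norm_mul, Real.norm_of_nonneg (exitKernel_nonneg p l)]
    exact mul_le_mul_of_nonneg_left (hf l) (exitKernel_nonneg p l)

/-! ### The exit operator applied to the even coefficients -/

lemma cayleyCoeff_one_half (p : ℕ) :
    evenCoeff (1 / 2) p = pochCoeff (1 / 2) p ∧ oddCoeff (1 / 2) p = pochCoeff (1 / 2) p := by
  induction p with
  | zero => simp
  | succ p ih =>
    obtain ⟨h1, h2⟩ := ih
    have h3 := evenCoeff_succ (1 / 2) p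
    have h4 := oddCoeff_succ (1 / 2) p
    have h5 := pochCoeff_succ (1 / 2) p
    rw [h1, h2] at h3
    have hp : (p : ℝ) + 1 ≠ 0 := by positivity
    have h6 : evenCoeff (1 / 2) (p + 1) = pochCoeff (1 / 2) (p + 1) := by
      refine mul_left_cancel₀ hp ?_
      rw [h3, h5]; field_simp
    refine ⟨h6, ?_⟩
    rw [h6, h2] at h4
    refine mul_left_cancel₀ (by positivity : 2 * (p : ℝ) + 3 ≠ 0) ?_
    rw [h4, h5]; field_simp; ring

lemma pochCoeff_one_half_three_term (p : ℕ) :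
    (2 * (p : ℝ) + 3) * (p + 2) * pochCoeff (1 / 2) (p + 2)
      - 4 * (p + 1) ^ 2 * pochCoeff (1 / 2) (p + 1)
      + (2 * p + 1) * p * pochCoeff (1 / 2) p = 1 / 2 * pochCoeff (1 / 2) (p + 1) := by
  have h := evenCoeff_three_term (1 / 2) p
  simp only [(cayleyCoeff_one_half _).1] at h
  rw [h]; ring

/-- The operator of `evenCoeff_three_term` acting in p agrees with its transpose acting in l, except
for a rank-one term proportional to u. -/
lemma exitKernel_commutation (p l : ℕ) :
    (2 * (p : ℝ) + 3) * (p + 2) * exitKernel (p + 2) (l + 1)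
      - 4 * (p + 1) ^ 2 * exitKernel (p + 1) (l + 1) + (2 * p + 1) * p * exitKernel p (l + 1)
      - exitKernel 1 (l + 1) * pochCoeff (1 / 2) (p + 1) =
    (2 * (l : ℝ) + 1) * (l + 1) * exitKernel (p + 1) l
      - 4 * (l + 1) ^ 2 * exitKernel (p + 1) (l + 1)
      + (2 * l + 3) * (l + 1) * exitKernel (p + 1) (l + 2) := by
  have hp2 := pochCoeff_succ (1 / 2) (p + 1)
  have hp1 := pochCoeff_succ (1 / 2) p
  have hl2 := pochCoeff_succ (1 / 2) (l + 1)
  have hl1 := pochCoeff_succ (1 / 2) l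
  simp only [exitKernel, pochCoeff_one]
  rw [hp2, hl2, hp1, hl1]
  push_cast
  have h1 : (p : ℝ) + 1 ≠ 0 := by positivity
  have h2 : (p : ℝ) + 1 + 1 ≠ 0 := by positivity
  have h3 : (l : ℝ) + 1 ≠ 0 := by positivity
  have h4 : (l : ℝ) + 1 + 1 ≠ 0 := by positivity
  have h5 : (p : ℝ) + 2 + (l + 1) ≠ 0 := by positivity
  have h6 : (p : ℝ) + 1 + (l + 1) ≠ 0 := by positivity
  have h7 : (p : ℝ) + (l + 1) ≠ 0 := by positivity
  have h8 : (p : ℝ) + 1 + l ≠ 0 := by positivity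
  have h9 : (p : ℝ) + 1 + (l + 2) ≠ 0 := by positivity
  have h10 : (1 : ℝ) + (l + 1) ≠ 0 := by positivity
  field_simp
  ring

/-- The image of the even coefficients under the exit kernel. -/
def exitEvenCoeff (a : ℝ) (p : ℕ) : ℝ := ∑' l, exitKernel p l * evenCoeff a l

lemma abs_evenCoeff_le {a : ℝ} (ha : 0 < a) (ha1 : a ≤ 1) (l : ℕ) : |evenCoeff a l| ≤ 2 := by
  rw [abs_of_pos (evenCoeff_pos ha l)]; exact evenCoeff_le_two ha ha1 l

lemma hasSum_exitEvenCoeff {a : ℝ} (ha : 0 < a) (ha1 : a ≤ 1) (p : ℕ) :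
    HasSum (fun l => exitKernel p l * evenCoeff a l) (exitEvenCoeff a p) :=
  (summable_exitKernel_mul p (abs_evenCoeff_le ha ha1)).hasSum

/-- The boundary term in the summation by parts of the three-term recurrence against the
exit kernel. -/
def exitBoundary (a : ℝ) (p n : ℕ) : ℝ :=
  (2 * (n : ℝ) + 1) * (n * exitKernel p (n + 1) * evenCoeff a n
    - (n + 1) * exitKernel p n * evenCoeff a (n + 1))

/-- Discrete Green identity: moving the operator from the kernel to its eigenvector leaves only a
boundary term. The index 0 lies outside the commutation relation and is checked in the base case. -/
lemma sum_exitKernel_three_term (a : ℝ) (p n : ℕ) :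
    ∑ l ∈ Finset.range (n + 1), ((2 * (p : ℝ) + 3) * (p + 2) * exitKernel (p + 2) l
      - 4 * (p + 1) ^ 2 * exitKernel (p + 1) l + (2 * p + 1) * p * exitKernel p l
      - exitKernel 1 l * pochCoeff (1 / 2) (p + 1)
      - 2 * a ^ 2 * exitKernel (p + 1) l) * evenCoeff a l = exitBoundary a (p + 1) n := by
  induction n with
  | zero =>
    have h := pochCoeff_one_half_three_term p
    have h0 : (p : ℝ) * exitKernel p 0 = p * pochCoeff (1 / 2) p := by
      rcases eq_or_ne p 0 with rfl | hp
      · simp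
      · rw [exitKernel_zero_right hp]
    rw [zero_add, Finset.sum_range_one, exitBoundary, exitKernel_zero_right (by omega),
      exitKernel_zero_right (by omega), exitKernel_zero_right one_ne_zero, pochCoeff_one, zero_add,
      evenCoeff_one, evenCoeff_zero]
    push_cast
    linear_combination h + (2 * (p : ℝ) + 1) * h0
  | succ n ih =>
    rw [Finset.sum_range_succ, ih, exitBoundary, exitBoundary]
    have h1 := exitKernel_commutation p n
    have h2 := evenCoeff_three_term a n
    push_cast
    linear_combination evenCoeff a (n + 1) * h1 + exitKernel (p + 1) (n + 1) * h2

lemma exitKernel_succ_sub (p l : ℕ) : ((l : ℝ) + 1) * |exitKernel (p + 1) (l + 1) -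
    exitKernel (p + 1) l| ≤ 3 / 2 * exitKernel (p + 1) l := by
  have hl1 := pochCoeff_succ (1 / 2) l
  have h3 : (l : ℝ) + 1 ≠ 0 := by positivity
  have h6 : (p : ℝ) + 1 + (l + 1) ≠ 0 := by positivity
  have h8 : (p : ℝ) + 1 + l ≠ 0 := by positivity
  have hK := exitKernel_nonneg (p + 1) l
  have h : exitKernel (p + 1) (l + 1) - exitKernel (p + 1) l =
      -(((1 / (p + 1 + (l + 1)) + 1 / (2 * ((l : ℝ) + 1)) * ((p + 1 + l) / (p + 1 + (l + 1))))) *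
        exitKernel (p + 1) l) := by
    simp only [exitKernel, hl1]
    push_cast
    field_simp
    ring
  rw [h, abs_neg, abs_of_nonneg (by positivity), ← mul_assoc]
  refine mul_le_mul_of_nonneg_right ?_ hK
  have hp : (0 : ℝ) ≤ p := by positivity
  have e1 : ((l : ℝ) + 1) * (1 / (p + 1 + (l + 1))) ≤ 1 := by
    rw [mul_one_div, div_le_one (by positivity)]; linarith
  have e2 : ((p : ℝ) + 1 + l) / (p + 1 + (l + 1)) ≤ 1 := by
    rw [div_le_one (by positivity)]; linarith
  have e3 : ((l : ℝ) + 1) * (1 / (2 * ((l : ℝ) + 1))) = 1 / 2 := by field_simp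
  rw [mul_add, ← mul_assoc, e3]
  linarith

lemma tendsto_exitBoundary {a : ℝ} (ha : 0 < a) (ha1 : a ≤ 1) (p : ℕ) :
    Tendsto (exitBoundary a (p + 1)) atTop (𝓝 0) := by
  have hlim := (tendsto_pochCoeff_atTop_zero (s := 1 / 2) (by norm_num) (by norm_num)).const_mul
    (10 * (((p : ℝ) + 1) * pochCoeff (1 / 2) (p + 1)))
  rw [mul_zero] at hlim
  refine squeeze_zero_norm (fun n => ?_) hlim
  have h1 := evenCoeff_succ a n
  -- Separately the two terms are too large. The recurrence exposes a difference of kernels, which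
  -- gains a factor 1/n, so the whole is of order n K(p+1,n), that is of order u_n.
  have h2 : exitBoundary a (p + 1) n = (2 * (n : ℝ) + 1) *
      (n * (exitKernel (p + 1) (n + 1) - exitKernel (p + 1) n) * evenCoeff a n -
        exitKernel (p + 1) n * (a * oddCoeff a n)) := by
    rw [exitBoundary]
    linear_combination -(2 * (n : ℝ) + 1) * exitKernel (p + 1) n * h1
  have hK := exitKernel_nonneg (p + 1) n
  have h3 : |(n : ℝ) * (exitKernel (p + 1) (n + 1) - exitKernel (p + 1) n) * evenCoeff a n| ≤
      3 / 2 * exitKernel (p + 1) n * 2 := by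
    rw [abs_mul]
    refine mul_le_mul ?_ (abs_evenCoeff_le ha ha1 n) (abs_nonneg _) (by positivity)
    rw [abs_mul, Nat.abs_cast]
    refine le_trans ?_ (exitKernel_succ_sub p n)
    gcongr; linarith
  have h4 : |exitKernel (p + 1) n * (a * oddCoeff a n)| ≤ exitKernel (p + 1) n * 2 := by
    have h5 : 0 ≤ a * oddCoeff a n := (mul_pos ha (oddCoeff_pos ha n)).le
    rw [abs_of_nonneg (mul_nonneg hK h5)]
    exact mul_le_mul_of_nonneg_left (mul_oddCoeff_le ha ha1 n) hK
  have h5 : (2 * (n : ℝ) + 1) * exitKernel (p + 1) n ≤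
      2 * (((p : ℝ) + 1) * pochCoeff (1 / 2) (p + 1)) * pochCoeff (1 / 2) n := by
    have e1 := pochCoeff_nonneg (s := 1 / 2) (by norm_num) (p + 1)
    have e2 := pochCoeff_nonneg (s := 1 / 2) (by norm_num) n
    have e3 : (2 * (n : ℝ) + 1) / (p + 1 + n) ≤ 2 := by
      rw [div_le_iff₀ (by positivity)]
      linarith [(Nat.cast_nonneg p : (0 : ℝ) ≤ p)]
    calc _ = (2 * (n : ℝ) + 1) / (p + 1 + n) *
          (((p : ℝ) + 1) * pochCoeff (1 / 2) (p + 1) * pochCoeff (1 / 2) n) := by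
          rw [exitKernel]; push_cast; ring
      _ ≤ 2 * (((p : ℝ) + 1) * pochCoeff (1 / 2) (p + 1) * pochCoeff (1 / 2) n) := by gcongr
      _ = _ := by ring
  rw [h2, norm_mul, Real.norm_of_nonneg (by positivity)]
  calc _ ≤ (2 * (n : ℝ) + 1) * (3 / 2 * exitKernel (p + 1) n * 2 + exitKernel (p + 1) n * 2) := by
        gcongr
        exact (norm_sub_le _ _).trans (add_le_add h3 h4)
    _ = 5 * ((2 * (n : ℝ) + 1) * exitKernel (p + 1) n) := by ring
    _ ≤ 5 * (2 * (((p : ℝ) + 1) * pochCoeff (1 / 2) (p + 1)) * pochCoeff (1 / 2) n) := by gcongr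
    _ = _ := by ring

lemma exitEvenCoeff_three_term {a : ℝ} (ha : 0 < a) (ha1 : a ≤ 1) (p : ℕ) :
    (2 * (p : ℝ) + 3) * (p + 2) * exitEvenCoeff a (p + 2)
      - 4 * (p + 1) ^ 2 * exitEvenCoeff a (p + 1) + (2 * p + 1) * p * exitEvenCoeff a p =
    2 * a ^ 2 * exitEvenCoeff a (p + 1) + exitEvenCoeff a 1 * pochCoeff (1 / 2) (p + 1) := by
  have h := fun p => hasSum_exitEvenCoeff ha ha1 p
  have h1 := (((((h (p + 2)).mul_left ((2 * (p : ℝ) + 3) * (p + 2))).sub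
    ((h (p + 1)).mul_left (4 * ((p : ℝ) + 1) ^ 2))).add
    ((h p).mul_left ((2 * (p : ℝ) + 1) * p))).sub
    ((h 1).mul_right (pochCoeff (1 / 2) (p + 1)))).sub ((h (p + 1)).mul_left (2 * a ^ 2))
  have h2 := (tendsto_add_atTop_iff_nat 1).2 h1.tendsto_sum_nat
  have h3 := tendsto_nhds_unique (h2.congr fun n => ?_) (tendsto_exitBoundary ha ha1 p)
  · linarith
  · rw [← sum_exitKernel_three_term]
    exact Finset.sum_congr rfl fun l _ => by ring

/-- Both sides solve the same inhomogeneous recurrence. The coefficient of the index p vanishes at p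
= 0, so the value at 1 determines the solution, and there e_1 - u_1 = 2a² - 1/2. -/
lemma exitEvenCoeff_eq_mul {a : ℝ} (ha : 1 / 2 < a) (ha1 : a ≤ 1) (p : ℕ) :
    exitEvenCoeff a (p + 1) = exitEvenCoeff a 1 / (2 * a ^ 2 - 1 / 2) *
      (evenCoeff a (p + 1) - pochCoeff (1 / 2) (p + 1)) := by
  have hd : 2 * a ^ 2 - 1 / 2 ≠ 0 := by nlinarith
  suffices h : ∀ p : ℕ, exitEvenCoeff a (p + 1) = exitEvenCoeff a 1 / (2 * a ^ 2 - 1 / 2) *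
      (evenCoeff a (p + 1) - pochCoeff (1 / 2) (p + 1)) ∧
      (p : ℝ) * exitEvenCoeff a p = p * (exitEvenCoeff a 1 / (2 * a ^ 2 - 1 / 2) *
      (evenCoeff a p - pochCoeff (1 / 2) p)) from (h p).1
  intro p
  induction p with
  | zero => refine ⟨?_, by simp⟩; rw [zero_add, evenCoeff_one, pochCoeff_one, div_mul_cancel₀ _ hd]
  | succ p ih =>
    obtain ⟨h1, h2⟩ := ih
    refine ⟨?_, by rw [h1]⟩
    have h3 := exitEvenCoeff_three_term (by linarith) ha1 p
    have h4 := evenCoeff_three_term a p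
    have h5 := pochCoeff_one_half_three_term p
    set γ := exitEvenCoeff a 1 / (2 * a ^ 2 - 1 / 2) with hγ
    have h6 : exitEvenCoeff a 1 = γ * (2 * a ^ 2 - 1 / 2) := by
      rw [hγ, div_mul_cancel₀ _ hd]
    rw [h1, h6] at h3
    refine mul_left_cancel₀ (by positivity : (2 * (p : ℝ) + 3) * (p + 2) ≠ 0) ?_
    linear_combination h3 - (2 * (p : ℝ) + 1) * h2 - γ * h4 + γ * h5

/-- Abelian comparison: finitely many l contribute O(u_p), which is negligible against Y, and on the
rest f is within ε/2 of r in units of y. -/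
lemma tendsto_exitKernel_sum_div {f y F Y : ℕ → ℝ} {r : ℝ} (hy : ∀ l, 0 < y l)
    (hY : ∀ p, p ≠ 0 → HasSum (fun l => exitKernel p l * y l) (Y p)) (hY0 : ∀ p, p ≠ 0 → 0 < Y p)
    (hF : ∀ p, p ≠ 0 → HasSum (fun l => exitKernel p l * f l) (F p))
    (hfy : Tendsto (fun l => f l / y l) atTop (𝓝 r))
    (huY : Tendsto (fun p => pochCoeff (1 / 2) p / Y p) atTop (𝓝 0)) :
    Tendsto (fun p => F p / Y p) atTop (𝓝 r) := by
  rw [Metric.tendsto_atTop] at hfy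
  rw [← tendsto_sub_nhds_zero_iff, Metric.tendsto_nhds]
  intro ε hε
  obtain ⟨N, hN⟩ := hfy (ε / 2) (half_pos hε)
  have hlim := huY.mul_const (∑ l ∈ Finset.range N, |f l - r * y l|)
  rw [zero_mul] at hlim
  filter_upwards [hlim.eventually_lt_const (half_pos hε), eventually_ne_atTop 0] with p hp hp0
  have hb : |F p - r * Y p| ≤ pochCoeff (1 / 2) p * (∑ l ∈ Finset.range N, |f l - r * y l|) +
      ε / 2 * Y p := by
    have h1 := (hF p hp0).sub ((hY p hp0).mul_left r)
    have h2 : HasSum (fun l => if l ∈ Finset.range N then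
        pochCoeff (1 / 2) p * |f l - r * y l| else 0)
        (∑ l ∈ Finset.range N, pochCoeff (1 / 2) p * |f l - r * y l|) := by
      rw [← Finset.sum_congr rfl fun l hl => if_pos hl]
      exact hasSum_sum_of_ne_finset_zero fun l hl => if_neg hl
    have h3 := h2.add ((hY p hp0).mul_left (ε / 2))
    rw [Finset.mul_sum, ← h1.tsum_eq]
    refine tsum_of_norm_bounded (E := ℝ) h3 fun l => ?_
    have hK := exitKernel_nonneg p l
    have e1 : exitKernel p l * f l - r * (exitKernel p l * y l) =
        exitKernel p l * (f l - r * y l) := by ring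
    rw [e1, norm_mul, Real.norm_of_nonneg hK, Real.norm_eq_abs]
    have e2 := mul_nonneg (half_pos hε).le (mul_nonneg hK (hy l).le)
    split_ifs with hl
    · have := mul_le_mul_of_nonneg_right (exitKernel_le p l) (abs_nonneg (f l - r * y l))
      linarith
    · rw [zero_add]
      have h4 := (hN l (by simpa using hl)).le
      have h5 : f l - r * y l = (f l / y l - r) * y l := by
        have := (hy l).ne'
        field_simp
      rw [h5, abs_mul, abs_of_pos (hy l)]
      rw [Real.dist_eq] at h4
      have := mul_le_mul_of_nonneg_left (mul_le_mul_of_nonneg_right h4 (hy l).le) hK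
      linarith
  have hYp := hY0 p hp0
  rw [Real.dist_eq, sub_zero]
  have h6 : F p / Y p - r = (F p - r * Y p) / Y p := by field_simp
  rw [h6, abs_div, abs_of_pos hYp, div_lt_iff₀ hYp]
  have h7 : pochCoeff (1 / 2) p * (∑ l ∈ Finset.range N, |f l - r * y l|) < ε / 2 * Y p := by
    rw [div_mul_eq_mul_div, div_lt_iff₀ hYp] at hp
    exact hp
  linarith

lemma exitEvenCoeff_eq {b : ℝ} (hb : 0 < b) (hb2 : b < 1 / 2) {p : ℕ} (hp : p ≠ 0) :
    exitEvenCoeff (1 - b) p =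
      (evenCoeff (1 - b) p - pochCoeff (1 / 2) p) / Real.cos (Real.pi * b) := by
  have ha : 0 < 1 - b := by linarith
  have ha1 : 1 - b ≤ 1 := by linarith
  have hu := pochCoeff_pos (s := 1 / 2) (by norm_num)
  have hs := pochCoeff_pos (s := 1 / 2 - b) (by linarith)
  have hs' := pochCoeff_pos (s := 1 - (1 / 2 - b)) (by linarith)
  have he := evenCoeff_pos ha
  have hlu := tendsto_pochCoeff_mul_rpow (s := 1 / 2) (by norm_num) (by norm_num)
  have hls := tendsto_pochCoeff_mul_rpow (s := 1 / 2 - b) (by linarith) (by linarith)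
  have hls' := tendsto_pochCoeff_mul_rpow (s := 1 - (1 / 2 - b)) (by linarith) (by linarith)
  have hla := tendsto_pochCoeff_mul_rpow ha ha1
  have hle := tendsto_evenCoeff_div_pochCoeff (f := id) (g := fun _ => 1 - b) tendsto_id
    (Eventually.of_forall fun _ => ⟨ha, ha1⟩) ⟨ha, ha1⟩ tendsto_const_nhds
  have hG1 := (Real.Gamma_pos_of_pos (s := 1 / 2) (by norm_num)).ne'
  have hG2 := (Real.Gamma_pos_of_pos (s := 1 / 2 - b) (by linarith)).ne'
  have hG3 := (Real.Gamma_pos_of_pos (s := 1 - (1 / 2 - b)) (by linarith)).ne'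
  have hG4 := (Real.Gamma_pos_of_pos ha).ne'
  -- The explicit pair with s = 1/2 - b, so that y has the same order l^{-b} as the even
  -- coefficients.
  set y : ℕ → ℝ := fun l => pochCoeff (1 / 2 - b) l / pochCoeff (1 / 2) l with hy
  set Y : ℕ → ℝ := fun p => pochCoeff (1 / 2) p / pochCoeff (1 - (1 / 2 - b)) p with hY
  set r : ℝ := (4 : ℝ) ^ (1 - b) / 2 * (Real.Gamma (1 - b))⁻¹ * (Real.Gamma (1 / 2))⁻¹ /
    (Real.Gamma (1 / 2 - b))⁻¹ with hr
  have hr0 : r ≠ 0 := by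
    rw [hr]
    have : (0 : ℝ) < 4 ^ (1 - b) := by positivity
    positivity
  have hey : Tendsto (fun l => evenCoeff (1 - b) l / y l) atTop (𝓝 r) := by
    refine (((hle.mul hla).mul hlu).div hls (inv_ne_zero hG2)).congr' ?_
    filter_upwards [eventually_gt_atTop 0] with l hl
    have hl' : (0 : ℝ) < l := by exact_mod_cast hl
    have h1 : (l : ℝ) ^ (1 - (1 / 2 - b)) = (l : ℝ) ^ (1 - (1 - b)) * (l : ℝ) ^ (1 - (1 / 2 : ℝ)) := by
      rw [← Real.rpow_add hl']; congr 1; ring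
    have := (hu l).ne'
    have := (hs l).ne'
    have := (pochCoeff_pos ha l).ne'
    have : (l : ℝ) ^ (1 - (1 - b)) ≠ 0 := by positivity
    have : (l : ℝ) ^ (1 - (1 / 2 : ℝ)) ≠ 0 := by positivity
    simp only [hy, Pi.div_apply, id]
    rw [h1]
    field_simp
  have hcos : 0 < Real.cos (Real.pi * b) := by
    refine Real.cos_pos_of_mem_Ioo ⟨?_, ?_⟩ <;> nlinarith [Real.pi_pos]
  -- The limit is Γ(1/2-b)Γ(1/2+b)/π, which the reflection formula evaluates; it becomes the
  -- constant γ.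
  have hYy : Tendsto (fun p => Y p / y p) atTop (𝓝 (1 / Real.cos (Real.pi * b))) := by
    have h2 := (hlu.mul hlu).div (hls.mul hls') (mul_ne_zero (inv_ne_zero hG2) (inv_ne_zero hG3))
    have h3 : (Real.Gamma (1 / 2))⁻¹ * (Real.Gamma (1 / 2))⁻¹ /
        ((Real.Gamma (1 / 2 - b))⁻¹ * (Real.Gamma (1 - (1 / 2 - b)))⁻¹) =
        1 / Real.cos (Real.pi * b) := by
      rw [← mul_inv, ← mul_inv, Real.Gamma_mul_Gamma_one_sub, Real.Gamma_one_half_eq,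
        Real.mul_self_sqrt Real.pi_pos.le,
        show Real.pi * (1 / 2 - b) = Real.pi / 2 - Real.pi * b by ring, Real.sin_pi_div_two_sub]
      have := Real.pi_pos.ne'
      field_simp
    rw [h3] at h2
    refine h2.congr' ?_
    filter_upwards [eventually_gt_atTop 0] with l hl
    have hl' : (0 : ℝ) < l := by exact_mod_cast hl
    have h1 : (l : ℝ) ^ (1 - (1 / 2 : ℝ)) * (l : ℝ) ^ (1 - (1 / 2 : ℝ)) =
        (l : ℝ) ^ (1 - (1 / 2 - b)) * (l : ℝ) ^ (1 - (1 - (1 / 2 - b))) := by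
      rw [← Real.rpow_add hl', ← Real.rpow_add hl']; congr 1; ring
    have := (hu l).ne'
    have := (hs l).ne'
    have := (hs' l).ne'
    have h4 : (l : ℝ) ^ (1 - (1 / 2 - b)) ≠ 0 := by positivity
    have h5 : (l : ℝ) ^ (1 - (1 - (1 / 2 - b))) ≠ 0 := by positivity
    simp only [hy, hY, Pi.div_apply]
    rw [mul_mul_mul_comm, h1]
    generalize (l : ℝ) ^ (1 - (1 / 2 - b)) = A at h4 ⊢
    generalize (l : ℝ) ^ (1 - (1 - (1 / 2 - b))) = B at h5 ⊢
    field_simp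
  have huY : Tendsto (fun p => pochCoeff (1 / 2) p / Y p) atTop (𝓝 0) := by
    refine (tendsto_pochCoeff_atTop_zero (s := 1 - (1 / 2 - b)) (by linarith)
      (by linarith)).congr fun p => ?_
    have := (hu p).ne'
    have := (hs' p).ne'
    simp only [hY]
    field_simp
  have hTY : Tendsto (fun p => exitEvenCoeff (1 - b) p / Y p) atTop (𝓝 r) := tendsto_exitKernel_sum_div (F := exitEvenCoeff (1 - b)) (f := evenCoeff (1 - b))
    (fun l => div_pos (hs l) (hu l))
    (fun p hp => hasSum_exitKernel_mul (s := 1 / 2 - b) (by linarith) (by linarith) hp)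
    (fun p _ => div_pos (hu p) (hs' p)) (fun p _ => hasSum_exitEvenCoeff ha ha1 p) hey huY
  have hy0 : ∀ p, y p ≠ 0 := fun p => (div_pos (hs p) (hu p)).ne'
  have hY0 : ∀ p, Y p ≠ 0 := fun p => (div_pos (hu p) (hs' p)).ne'
  have hye := hey.inv₀ hr0
  have hTe : Tendsto (fun p => exitEvenCoeff (1 - b) p / evenCoeff (1 - b) p) atTop
      (𝓝 (1 / Real.cos (Real.pi * b))) := by
    have h2 := (hTY.mul hYy).mul hye
    rw [mul_comm r, mul_assoc, mul_inv_cancel₀ hr0, mul_one] at h2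
    refine h2.congr fun p => ?_
    have := hy0 p
    have := hY0 p
    have := (he p).ne'
    field_simp
  have hue : Tendsto (fun p => pochCoeff (1 / 2) p / evenCoeff (1 - b) p) atTop (𝓝 0) := by
    have h2 := (huY.mul hYy).mul hye
    rw [zero_mul, zero_mul] at h2
    refine h2.congr fun p => ?_
    have := hy0 p
    have := hY0 p
    have := (he p).ne'
    field_simp
  have hγ := exitEvenCoeff_eq_mul (a := 1 - b) (by linarith) ha1
  set γ := exitEvenCoeff (1 - b) 1 / (2 * (1 - b) ^ 2 - 1 / 2)
  have h3 : Tendsto (fun p => exitEvenCoeff (1 - b) p / evenCoeff (1 - b) p) atTop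
      (𝓝 (γ * (1 - 0))) := by
    refine ((tendsto_const_nhds.sub hue).const_mul γ).congr' ?_
    filter_upwards [eventually_ne_atTop 0] with p hp
    obtain ⟨p, rfl⟩ := Nat.exists_eq_succ_of_ne_zero hp
    have := (he (p + 1)).ne'
    rw [Nat.succ_eq_add_one, hγ]
    field_simp
  have h4 := tendsto_nhds_unique h3 hTe
  rw [sub_zero, mul_one] at h4
  obtain ⟨p, rfl⟩ := Nat.exists_eq_succ_of_ne_zero hp
  rw [Nat.succ_eq_add_one, hγ, h4]
  ring

/-- The values of the harmonic extension of `hDown q` at the non-positive integer `-l`. -/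
def hDownNeg (q : ℝ) (l : ℕ) : ℝ := if l = 0 then 1 else q * hDown q l

/-- With h = e/(1+q) away from 0 and K e = (e-u)/q, the terms in u cancel against the extra mass at
l = 0. For q = 0 only the exit at 0 counts, and e = u. -/
lemma hDown_eq_exitKernel_sum {q : ℝ} (hq : 0 ≤ q) (hq1 : q < 1) {p : ℕ} (hp : p ≠ 0) :
    HasSum (fun l => exitKernel p l * hDownNeg q l) (hDown q p) := by
  have hq' : -1 < q := by linarith
  rcases hq.eq_or_lt with rfl | hq
  · rw [hDown_eq_evenCoeff hq' hq1.le hp, bExp_zero, show (1 : ℝ) - 1 / 2 = 1 / 2 by norm_num,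
      (cayleyCoeff_one_half p).1, ← exitKernel_zero_right hp]
    refine (hasSum_ite_eq (0 : ℕ) (exitKernel p 0 / (1 + 0))).congr_fun fun l => ?_
    by_cases hl : l = 0 <;> simp [hDownNeg, hl]
  · have hb := bExp_pos hq1
    have hb2 : bExp q < 1 / 2 := by
      rw [← bExp_zero, bExp, bExp]
      exact div_lt_div_of_pos_right (Real.strictAntiOn_arccos ⟨by norm_num, by norm_num⟩
        ⟨hq'.le, hq1.le⟩ hq) Real.pi_pos
    have h1 := hasSum_exitEvenCoeff (a := 1 - bExp q) (by linarith) (by linarith) p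
    rw [exitEvenCoeff_eq hb hb2 hp, cos_pi_mul_bExp hq'.le hq1.le] at h1
    have h2 := (h1.mul_left (q / (1 + q))).add (hasSum_ite_eq (0 : ℕ) (exitKernel p 0 / (1 + q)))
    have hq0 : 1 + q ≠ 0 := by linarith
    have h3 : q / (1 + q) * ((evenCoeff (1 - bExp q) p - pochCoeff (1 / 2) p) / q) +
        exitKernel p 0 / (1 + q) = hDown q p := by
      rw [exitKernel_zero_right hp, hDown_eq_evenCoeff hq' hq1.le hp]
      field_simp
      ring
    rw [h3] at h2
    refine h2.congr_fun fun l => ?_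
    rcases eq_or_ne l 0 with rfl | hl
    · simp [hDownNeg]; field_simp; ring
    · rw [hDownNeg, if_neg hl, if_neg hl, hDown_eq_evenCoeff hq' hq1.le hl]; ring

/-! ### Harmonicity of the exit kernel for admissible laws -/

lemma pochCoeff_one_half (n : ℕ) : pochCoeff (1 / 2) n = ((2 * n).choose n : ℝ) / 4 ^ n := by
  induction n with
  | zero => simp
  | succ n ih =>
    have h := Nat.succ_mul_centralBinom_succ n
    simp only [Nat.centralBinom] at h
    have h' : ((n : ℝ) + 1) * ((2 * (n + 1)).choose (n + 1) : ℝ) =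
        2 * (2 * n + 1) * ((2 * n).choose n : ℝ) := by exact_mod_cast h
    have hn : (n : ℝ) + 1 ≠ 0 := by positivity
    rw [pochCoeff_succ, ih, pow_succ]
    field_simp
    linear_combination -2 * h'

lemma h0_natCast (n : ℕ) : h0 n = pochCoeff (1 / 2) n := by
  rw [h0, if_pos (by positivity), Int.toNat_natCast, pochCoeff_one_half]

lemma h0_of_neg {p : ℤ} (hp : p < 0) : h0 p = 0 := if_neg (not_le.2 hp)

lemma h0_mem_Icc (p : ℤ) : h0 p ∈ Set.Icc (0 : ℝ) 1 := by
  rcases lt_or_ge p 0 with hp | hp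
  · rw [h0_of_neg hp]; simp
  · lift p to ℕ using hp
    rw [h0_natCast]
    exact ⟨pochCoeff_nonneg (by norm_num) p, by
      simpa using pochCoeff_antitone (s := 1 / 2) (by norm_num) (by norm_num) (Nat.zero_le p)⟩

/-- Compares the convolutions at (p,l) and (p+1,l-1) for partial sums. The discrepancy has the
factor l - m and vanishes for the full sum, so these convolutions depend only on p + l. -/
lemma sum_exitKernel_mul_eq {p : ℕ} (hp : p ≠ 0) {l : ℕ} (hl : l ≠ 0) {m : ℕ} (hm : m ≤ l) :
    ∑ j ∈ Finset.range (m + 1), exitKernel p j * pochCoeff (1 / 2) (l - j) =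
      ∑ j ∈ Finset.range m, exitKernel (p + 1) j * pochCoeff (1 / 2) (l - 1 - j) +
        pochCoeff (1 / 2) p * (((l : ℝ) - m) / l * (pochCoeff (1 / 2) m * pochCoeff (1 / 2) (l - m))) := by
  have hl' : (l : ℝ) ≠ 0 := by exact_mod_cast hl
  induction m with
  | zero => simp [exitKernel_zero_right hp, hl']
  | succ m ih =>
    rw [Finset.sum_range_succ, ih (by omega), Finset.sum_range_succ]
    obtain ⟨k, rfl⟩ := Nat.exists_eq_add_of_le hm
    rw [show m + 1 + k - m = k + 1 by omega, show m + 1 + k - (m + 1) = k by omega,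
      show m + 1 + k - 1 - m = k by omega]
    have h1 := pochCoeff_succ (1 / 2) p
    have h2 := pochCoeff_succ (1 / 2) m
    have h3 := pochCoeff_succ (1 / 2) k
    simp only [exitKernel]
    rw [h1, h2, h3]
    have e1 : (p : ℝ) + 1 ≠ 0 := by positivity
    have e2 : (m : ℝ) + 1 ≠ 0 := by positivity
    have e3 : (k : ℝ) + 1 ≠ 0 := by positivity
    have e4 : (p : ℝ) + (m + 1) ≠ 0 := by positivity
    have e5 : (p : ℝ) + 1 + m ≠ 0 := by positivity
    have e6 : (m : ℝ) + 1 + k ≠ 0 := by positivity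
    push_cast
    field_simp
    ring_nf

lemma pochCoeff_add_eq_sum {p : ℕ} (hp : p ≠ 0) (l : ℕ) : pochCoeff (1 / 2) (p + l) =
    ∑ j ∈ Finset.range (l + 1), exitKernel p j * pochCoeff (1 / 2) (l - j) := by
  induction l generalizing p with
  | zero => simp [exitKernel_zero_right hp]
  | succ l ih =>
    rw [sum_exitKernel_mul_eq hp l.succ_ne_zero le_rfl, show p + (l + 1) = p + 1 + l by ring,
      ih p.succ_ne_zero]
    simp

/-- The exit kernel as a function on `ℤ`, where the walk exits immediately from the non-positive
integers. -/
def exitProb (l : ℕ) (p : ℤ) : ℝ :=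
  if 0 < p then exitKernel p.toNat l else if p = -l then 1 else 0

lemma exitProb_nonneg (l : ℕ) (p : ℤ) : 0 ≤ exitProb l p := by
  unfold exitProb
  split_ifs
  · exact exitKernel_nonneg _ _
  · exact zero_le_one
  · exact le_rfl

lemma h0_add_eq_sum (p : ℤ) (l : ℕ) : h0 (p + l) =
    ∑ j ∈ Finset.range (l + 1), exitProb j p * pochCoeff (1 / 2) (l - j) := by
  rcases lt_or_ge 0 p with hp | hp
  · lift p to ℕ using hp.le
    have hp0 : p ≠ 0 := by rintro rfl; simp at hp
    simp only [exitProb, if_pos hp, Int.toNat_natCast]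
    rw [← pochCoeff_add_eq_sum hp0, ← h0_natCast]
    push_cast
    rfl
  · obtain ⟨m, rfl⟩ := Int.exists_eq_neg_ofNat hp
    have hE : ∀ j : ℕ, exitProb j (-(m : ℤ)) = if j = m then 1 else 0 := by
      intro j
      rw [exitProb, if_neg (by omega)]
      by_cases h : j = m
      · simp [h]
      · rw [if_neg h, if_neg (by omega)]
    simp only [hE, ite_mul, one_mul, zero_mul, Finset.sum_ite_eq', Finset.mem_range]
    split_ifs with h
    · rw [← h0_natCast]; congr 1; push_cast [Nat.lt_succ_iff.1 h]; ring_nf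
    · exact h0_of_neg (by omega)

lemma pmf_summable_toReal (ν : PMF ℤ) : Summable fun k => (ν k).toReal :=
  ENNReal.summable_toReal ν.tsum_coe_ne_top

lemma hasSum_h0 {ν : PMF ℤ} (hν : IsAdmissible ν) {l : ℤ} (hl : 1 ≤ l) :
    HasSum (fun k => h0 (l + k) * (ν k).toReal) (h0 l) := by
  rw [← hν.2 l hl]
  refine Summable.hasSum (Summable.of_nonneg_of_le (fun k => ?_) (fun k => ?_)
    (pmf_summable_toReal ν))
  · exact mul_nonneg (h0_mem_Icc _).1 ENNReal.toReal_nonneg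
  · exact mul_le_of_le_one_left ENNReal.toReal_nonneg (h0_mem_Icc _).2

/-- The coefficient of `exitProb l` in `h0_add_eq_sum` is 1, so it is a finite combination of p ↦
`h0 (p + l)`, harmonic by admissibility, and the exit functions of smaller index. -/
lemma hasSum_exitProb {ν : PMF ℤ} (hν : IsAdmissible ν) (l : ℕ) {p : ℤ} (hp : 1 ≤ p) :
    HasSum (fun k => exitProb l (p + k) * (ν k).toReal) (exitProb l p) := by
  induction l using Nat.strong_induction_on with
  | _ l ih =>
    have h1 : ∀ p : ℤ, exitProb l p = h0 (p + l) -
        ∑ j ∈ Finset.range l, exitProb j p * pochCoeff (1 / 2) (l - j) := by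
      intro p
      rw [h0_add_eq_sum, Finset.sum_range_succ]
      simp
    have h2 := (hasSum_h0 hν (l := p + l) (by omega)).sub
      (hasSum_sum fun j hj => (ih j (Finset.mem_range.1 hj)).mul_right (pochCoeff (1 / 2) (l - j)))
    rw [← h1] at h2
    refine h2.congr_fun fun k => ?_
    rw [h1, sub_mul, Finset.sum_mul, show p + k + l = p + l + k by ring]
    congr 1
    exact Finset.sum_congr rfl fun j _ => by ring

/-- The extension of `hDown q` to `ℤ` that takes reflected walks into account. -/
def hDownExt (q : ℝ) (p : ℤ) : ℝ := if 0 ≤ p then hDown q p.toNat else q * hDown q (-p).toNat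

lemma hDown_pos {q : ℝ} (h : -1 < q) (h1 : q ≤ 1) (p : ℕ) : 0 < hDown q p := (hDown_mem_Ioc h h1 p).1

lemma hDownNeg_nonneg {q : ℝ} (hq : 0 ≤ q) (hq1 : q ≤ 1) (l : ℕ) : 0 ≤ hDownNeg q l := by
  unfold hDownNeg
  split_ifs
  · exact zero_le_one
  · exact mul_nonneg hq (hDown_pos (by linarith) hq1 l).le

lemma hasSum_exitProb_mul {q : ℝ} (hq : 0 ≤ q) (hq1 : q < 1) (p : ℤ) :
    HasSum (fun l => exitProb l p * hDownNeg q l) (hDownExt q p) := by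
  rcases lt_or_ge 0 p with hp | hp
  · lift p to ℕ using hp.le
    have hp0 : p ≠ 0 := by rintro rfl; simp at hp
    simp only [exitProb, hDownExt, if_pos hp, if_pos hp.le, Int.toNat_natCast]
    exact hDown_eq_exitKernel_sum hq hq1 hp0
  · obtain ⟨m, rfl⟩ := Int.exists_eq_neg_ofNat hp
    have hE : hDownExt q (-(m : ℤ)) = hDownNeg q m := by
      rcases eq_or_ne m 0 with rfl | hm
      · simp [hDownExt, hDownNeg]
      · rw [hDownExt, if_neg (by omega), hDownNeg, if_neg hm]; simp
    rw [hE]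
    refine (hasSum_ite_eq m (hDownNeg q m)).congr_fun fun j => ?_
    rw [exitProb, if_neg (by omega)]
    by_cases h : j = m
    · subst h; simp
    · rw [if_neg h, if_neg (by omega), zero_mul]

/-- The extension of h is a nonnegative mixture of the harmonic functions `exitProb l`; Tonelli
exchanges the sums over exit points and steps. -/
lemma ofReal_hDownExt_eq_tsum {ν : PMF ℤ} (hν : IsAdmissible ν) {q : ℝ} (hq : 0 ≤ q) (hq1 : q < 1)
    {p : ℤ} (hp : 1 ≤ p) :
    ENNReal.ofReal (hDownExt q p) = ∑' k, ν k * ENNReal.ofReal (hDownExt q (p + k)) := by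
  have h1 : ∀ p, ENNReal.ofReal (hDownExt q p) =
      ∑' l, ENNReal.ofReal (exitProb l p) * ENNReal.ofReal (hDownNeg q l) := by
    intro p
    have h := hasSum_exitProb_mul hq hq1 p
    rw [← h.tsum_eq, ENNReal.ofReal_tsum_of_nonneg (fun l => mul_nonneg (exitProb_nonneg l p)
      (hDownNeg_nonneg hq hq1.le l)) h.summable]
    exact tsum_congr fun l => ENNReal.ofReal_mul (exitProb_nonneg l p)
  have h2 : ∀ l, ENNReal.ofReal (exitProb l p) = ∑' k, ENNReal.ofReal (exitProb l (p + k)) * ν k := by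
    intro l
    have h := hasSum_exitProb hν l hp
    rw [← h.tsum_eq, ENNReal.ofReal_tsum_of_nonneg (fun k => mul_nonneg (exitProb_nonneg l _)
      ENNReal.toReal_nonneg) h.summable]
    refine tsum_congr fun k => ?_
    rw [ENNReal.ofReal_mul (exitProb_nonneg l _), ENNReal.ofReal_toReal (ν.apply_ne_top k)]
  rw [h1 p]
  simp only [h2, h1, ← ENNReal.tsum_mul_left, ← ENNReal.tsum_mul_right]
  rw [ENNReal.tsum_comm]
  exact tsum_congr fun k => tsum_congr fun l => by ring

/-! ### First-step recursion and the walk on path space -/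

section

/-- Reflection of a function on the non-negative integers to the negative integers, with
weight `q`. -/
def reflect (q : ℝ) (g : ℤ → ℝ≥0∞) (l : ℤ) : ℝ≥0∞ :=
  if 0 ≤ l then g l else ENNReal.ofReal q * g (-l)

/-- A ricochet to l > 0 is a step to -l followed by a reflection of weight q. Trapping at l < 0
contributes nothing because g vanishes there. -/
lemma tsum_stepProb_mul (ν : PMF ℤ) (q : I) {x : ℤ × ℤ} (hx : 0 < x.1) {g : ℤ → ℝ≥0∞}
    (hg : ∀ l < 0, g l = 0) :
    ∑' y, stepProb ν q x y * g y.1 = ∑' k, ν k * reflect q g (x.1 + k) := by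
  unfold stepProb
  simp only [if_pos hx, add_mul, ite_mul, zero_mul]
  rw [ENNReal.tsum_add, ENNReal.tsum_prod', ENNReal.tsum_prod']
  simp only [tsum_ite_eq]
  have h2 : ∑' l : ℤ, (if 0 < l then ENNReal.ofReal (q : ℝ) * ν (-l - x.1) * g l else 0)
      = ∑' l : ℤ, (if l < 0 then ENNReal.ofReal (q : ℝ) * ν (l - x.1) * g (-l) else 0) := by
    rw [← (Equiv.neg ℤ).tsum_eq]
    simp
  rw [h2, ← ENNReal.tsum_add, ← (Equiv.addLeft x.1).tsum_eq]
  refine tsum_congr fun k => ?_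
  simp only [Equiv.coe_addLeft, add_sub_cancel_left, reflect]
  by_cases hl : x.1 + k < 0
  · rw [hg _ hl, if_neg (not_le.2 hl), if_pos hl]; ring
  · simp [hl, not_lt.1 hl]

/-- The probability that the `q`-ricocheted walk started at `w` is at `0` at time `n`. -/
def zeroProb (ν : PMF ℤ) (q : ℝ) : ℕ → ℤ → ℝ≥0∞
  | 0, w => if w = 0 then 1 else 0
  | n + 1, w => if 0 < w then ∑' k, ν k * reflect q (zeroProb ν q n) (w + k) else zeroProb ν q n w

variable {ν : PMF ℤ} {q : ℝ}

lemma zeroProb_of_neg (n : ℕ) {w : ℤ} (hw : w < 0) : zeroProb ν q n w = 0 := by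
  induction n with
  | zero => rw [zeroProb, if_neg hw.ne]
  | succ n ih => rw [zeroProb, if_neg (by omega), ih]

lemma zeroProb_zero (n : ℕ) : zeroProb ν q n 0 = 1 := by
  induction n with
  | zero => rw [zeroProb, if_pos rfl]
  | succ n ih => rw [zeroProb, if_neg (by omega), ih]

lemma tsum_stepProb_mul_zeroProb (ν : PMF ℤ) (q : I) (n : ℕ) (x : ℤ × ℤ) :
    ∑' y, stepProb ν q x y * zeroProb ν q n y.1 = zeroProb ν q (n + 1) x.1 := by
  rw [zeroProb]
  split_ifs with hx
  · exact tsum_stepProb_mul ν q hx fun l hl => zeroProb_of_neg n hl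
  · unfold stepProb
    simp [hx]

lemma reflect_mono {q q' : ℝ} (hq : q ≤ q') {g g' : ℤ → ℝ≥0∞} (hg : ∀ l, g l ≤ g' l) (l : ℤ) :
    reflect q g l ≤ reflect q' g' l := by
  unfold reflect
  split_ifs
  · exact hg l
  · exact mul_le_mul' (ENNReal.ofReal_le_ofReal hq) (hg _)

lemma zeroProb_mono_right {q q' : ℝ} (hq : q ≤ q') (n : ℕ) (w : ℤ) :
    zeroProb ν q n w ≤ zeroProb ν q' n w := by
  induction n generalizing w with
  | zero => exact le_rfl
  | succ n ih =>
    simp only [zeroProb]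
    split_ifs
    · exact ENNReal.tsum_le_tsum fun k => mul_le_mul_right (reflect_mono hq ih _) _
    · exact ih w

lemma zeroProb_le_succ (n : ℕ) (w : ℤ) : zeroProb ν q n w ≤ zeroProb ν q (n + 1) w := by
  induction n generalizing w with
  | zero =>
    simp only [zeroProb]
    split_ifs <;> first | omega | simp
  | succ n ih =>
    rw [zeroProb, zeroProb]
    split_ifs
    · exact ENNReal.tsum_le_tsum fun k => mul_le_mul_right (reflect_mono le_rfl ih _) _
    · exact ih w

lemma monotone_zeroProb (w : ℤ) : Monotone fun n => zeroProb ν q n w :=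
  monotone_nat_of_le_succ fun n => zeroProb_le_succ n w

section PathSpace

variable (ν : PMF ℤ) (q : I) (k : ℤ)

instance : IsProbabilityMeasure (walkLaw ν q k) := by
  unfold walkLaw; infer_instance

lemma lintegral_walkLaw_zero (g : ℤ × ℤ → ℝ≥0∞) :
    ∫⁻ w, g (w 0) ∂walkLaw ν q k = g (k, 0) := by
  have hg : Measurable g := measurable_of_countable g
  have h1 : (walkLaw ν q k).map (Preorder.frestrictLe 0) =
      (Measure.dirac (k, (0 : ℤ))).map
        (MeasurableEquiv.piUnique (fun _ : Finset.Iic 0 => ℤ × ℤ)).symm := by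
    rw [walkLaw, Kernel.trajMeasure, Measure.map_comp _ _ (by fun_prop),
      Kernel.traj_map_frestrictLe, Kernel.partialTraj_self, Measure.id_comp]
  have h2 : ∫⁻ w, g (w 0) ∂walkLaw ν q k =
      ∫⁻ v, g (v ⟨0, Finset.mem_Iic.2 le_rfl⟩) ∂(walkLaw ν q k).map (Preorder.frestrictLe 0) := by
    rw [lintegral_map (by fun_prop) (by fun_prop)]
    rfl
  rw [h2, h1, lintegral_map (by fun_prop) (by fun_prop), lintegral_dirac]
  rfl

lemma lintegral_walkLaw_succ (m : ℕ) (g : ℤ × ℤ → ℤ × ℤ → ℝ≥0∞) :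
    ∫⁻ w, g (w m) (w (m + 1)) ∂walkLaw ν q k =
      ∫⁻ w, ∑' y, stepProb ν q (w m) y * g (w m) y ∂walkLaw ν q k := by
  have hg : Measurable (Function.uncurry g) := measurable_of_countable _
  have h := Kernel.map_frestrictLe_trajMeasure_compProd_eq_map_trajMeasure
    (X := fun _ => ℤ × ℤ) (μ₀ := Measure.dirac (k, (0 : ℤ))) (κ := fun n => (kernel ν q).comap
      (fun w : (Π _ : Finset.Iic n, ℤ × ℤ) => w ⟨n, Finset.mem_Iic.2 le_rfl⟩)
      (measurable_pi_apply _)) (a := m)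
  change (walkLaw ν q k).map _ ⊗ₘ _ = (walkLaw ν q k).map _ at h
  have hG : Measurable fun z : (Π _ : Finset.Iic m, ℤ × ℤ) × (ℤ × ℤ) =>
      g (z.1 ⟨m, Finset.mem_Iic.2 le_rfl⟩) z.2 :=
    Measurable.comp (f := fun z : (Π _ : Finset.Iic m, ℤ × ℤ) × (ℤ × ℤ) =>
      (z.1 ⟨m, Finset.mem_Iic.2 le_rfl⟩, z.2)) hg (by fun_prop)
  have h1 : ∫⁻ w, g (w m) (w (m + 1)) ∂walkLaw ν q k =
      ∫⁻ z, g (z.1 ⟨m, Finset.mem_Iic.2 le_rfl⟩) z.2 ∂(walkLaw ν q k).map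
        (fun x => (Preorder.frestrictLe m x, x (m + 1))) := by
    rw [lintegral_map hG (by fun_prop)]
    rfl
  rw [h1, ← h, Measure.lintegral_compProd hG, lintegral_map hG.lintegral_kernel_prod_right' (by fun_prop)]
  refine lintegral_congr fun w => ?_
  rw [Kernel.comap_apply]
  change ∫⁻ y, g (w m) y ∂(step ν q (w m)).toMeasure = _
  rw [lintegral_countable']
  refine tsum_congr fun y => ?_
  rw [PMF.toMeasure_apply_singleton _ _ (measurableSet_singleton y), mul_comm]
  rfl

end PathSpace

end

section

section TrappingEvent

variable (ν : PMF ℤ) (q : I) (k : ℤ)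

/-- The Markov property: integrating out the last step trades one unit of m for one unit of n. -/
lemma lintegral_walkLaw_zeroProb (n m : ℕ) :
    ∫⁻ w, zeroProb ν q n (w m).1 ∂walkLaw ν q k = zeroProb ν q (n + m) k := by
  induction m generalizing n with
  | zero => exact lintegral_walkLaw_zero ν q k fun x => zeroProb ν q n x.1
  | succ m ih =>
    rw [lintegral_walkLaw_succ ν q k m fun _ y => zeroProb ν q n y.1]
    simp only [tsum_stepProb_mul_zeroProb]
    rw [ih, add_right_comm, add_assoc]

lemma measurableSet_eq_zero (m : ℕ) : MeasurableSet {w : ℕ → ℤ × ℤ | (w m).1 = 0} :=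
  (measurable_fst.comp (measurable_pi_apply m)) (measurableSet_singleton 0)

lemma walkLaw_eq_zero (m : ℕ) :
    walkLaw ν q k {w | (w m).1 = 0} = zeroProb ν q m k := by
  rw [← zero_add m, ← lintegral_walkLaw_zeroProb, zero_add,
    ← lintegral_indicator_one (measurableSet_eq_zero m)]
  refine lintegral_congr fun w => ?_
  simp [zeroProb, Set.indicator_apply]

lemma ae_walkLaw_absorbed (m : ℕ) :
    ∀ᵐ w ∂walkLaw ν q k, (w m).1 = 0 → (w (m + 1)).1 = 0 := by
  have h := lintegral_walkLaw_succ ν q k m fun x y => if x.1 = 0 ∧ y.1 ≠ 0 then 1 else 0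
  have h0 : ∀ x : ℤ × ℤ,
      ∑' y, stepProb ν q x y * (if x.1 = 0 ∧ y.1 ≠ 0 then 1 else 0 : ℝ≥0∞) = 0 := by
    intro x
    rw [ENNReal.tsum_eq_zero]
    intro y
    by_cases hxy : x.1 = 0 ∧ y.1 ≠ 0
    · have hne : y ≠ x := fun h => hxy.2 (h ▸ hxy.1)
      simp [stepProb, hxy.1, hne]
    · simp [hxy]
  simp only [h0, lintegral_zero] at h
  rw [lintegral_eq_zero_iff] at h
  · filter_upwards [h] with w hw h1
    by_contra h2
    simp [h1, h2] at hw
  · have hg : Measurable fun z : (ℤ × ℤ) × (ℤ × ℤ) =>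
        (if z.1.1 = 0 ∧ z.2.1 ≠ 0 then 1 else 0 : ℝ≥0∞) := measurable_of_countable _
    exact Measurable.comp (f := fun w : ℕ → ℤ × ℤ => (w m, w (m + 1))) hg (by fun_prop)

/-- Almost surely 0 is absorbing, so staying at 0 from time n on and being at 0 at time n agree up
to a null set. Continuity of measure along the increasing events does the rest. -/
lemma walkLaw_trappedAtZero :
    walkLaw ν q k trappedAtZero = ⨆ n, zeroProb ν q n k := by
  have hset : trappedAtZero = ⋃ n, {w : ℕ → ℤ × ℤ | ∀ m, n ≤ m → (w m).1 = 0} := by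
    ext w; simp [trappedAtZero]
  have hmono : Monotone fun n => {w : ℕ → ℤ × ℤ | ∀ m, n ≤ m → (w m).1 = 0} :=
    fun a b hab w hw m hm => hw m (hab.trans hm)
  rw [hset, hmono.measure_iUnion]
  refine iSup_congr fun n => ?_
  rw [← walkLaw_eq_zero]
  refine measure_congr ?_
  have hall := ae_all_iff.2 (ae_walkLaw_absorbed ν q k)
  filter_upwards [hall] with w hw
  refine propext ⟨fun h => h n le_rfl, fun h m hm => ?_⟩
  induction m, hm using Nat.le_induction with
  | base => exact h
  | succ m _ ih => exact hw m ih

end TrappingEvent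

/-! ### The trapping probability equals h: comparison and maximum principle -/

variable {ν : PMF ℤ} {q : ℝ}

/-- The function `hDown q` on `ℤ`, extended by `0` to negative integers. -/
def hDownInt (q : ℝ) (w : ℤ) : ℝ := if w < 0 then 0 else hDown q w.toNat

lemma reflect_ofReal_hDownInt (h0 : 0 ≤ q) (l : ℤ) :
    reflect q (fun w => ENNReal.ofReal (hDownInt q w)) l = ENNReal.ofReal (hDownExt q l) := by
  unfold reflect hDownExt
  split_ifs with hl
  · simp only [hDownInt, if_neg hl.not_gt]
  · simp only [hDownInt, if_neg (show ¬ -l < 0 by omega), ENNReal.ofReal_mul h0]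

lemma zeroProb_le_ofReal_hDownInt (hν : IsAdmissible ν) (h0 : 0 ≤ q) (h1 : q < 1) (n : ℕ)
    (w : ℤ) : zeroProb ν q n w ≤ ENNReal.ofReal (hDownInt q w) := by
  induction n generalizing w with
  | zero =>
    rw [zeroProb]
    split_ifs with hw
    · simp [hw, hDownInt, hDown_zero]
    · exact zero_le
  | succ n ih =>
    rw [zeroProb]
    split_ifs with hw
    · obtain ⟨p, rfl⟩ := Int.eq_ofNat_of_zero_le hw.le
      have h := ofReal_hDownExt_eq_tsum hν h0 h1 (p := p) (by omega)
      calc _ ≤ ∑' k, ν k * reflect q (fun w => ENNReal.ofReal (hDownInt q w)) (p + k) :=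
            ENNReal.tsum_le_tsum fun k => mul_le_mul_right (reflect_mono le_rfl ih _) _
        _ = ENNReal.ofReal (hDownExt q p) := by
            rw [h]; simp only [reflect_ofReal_hDownInt h0]
        _ = _ := by rw [hDownExt, hDownInt, if_pos hw.le, if_neg hw.le.not_gt]
    · exact ih w

/-- The probability that the `q`-ricocheted walk started at `w` is ever at `0`. -/
def trapProb (ν : PMF ℤ) (q : ℝ) (w : ℤ) : ℝ≥0∞ := ⨆ n, zeroProb ν q n w

/-- Monotone convergence, for counting measure, in the first-step recursion. -/
lemma trapProb_eq_tsum {w : ℤ} (hw : 0 < w) :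
    trapProb ν q w = ∑' k, ν k * reflect q (trapProb ν q) (w + k) := by
  have h1 : trapProb ν q w = ⨆ n, ∑' k, ν k * reflect q (zeroProb ν q n) (w + k) := by
    unfold trapProb
    rw [← (monotone_zeroProb w).iSup_nat_add 1]
    simp only [zeroProb, if_pos hw]
  have h2 : ∀ l, reflect q (trapProb ν q) l = ⨆ n, reflect q (zeroProb ν q n) l := by
    intro l
    unfold reflect
    split_ifs
    · rfl
    · rw [← ENNReal.mul_iSup]; rfl
  simp only [h1, h2, ENNReal.mul_iSup, ← lintegral_count]
  refine (lintegral_iSup (fun n => measurable_of_countable _) fun n m hnm k => ?_).symm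
  exact mul_le_mul_right (reflect_mono le_rfl (fun l => monotone_zeroProb l hnm) _) _

lemma trapProb_zero : trapProb ν q 0 = 1 := by simp [trapProb, zeroProb_zero]

lemma trapProb_le_ofReal_hDownInt (hν : IsAdmissible ν) (h0 : 0 ≤ q) (h1 : q < 1) (w : ℤ) :
    trapProb ν q w ≤ ENNReal.ofReal (hDownInt q w) :=
  iSup_le fun n => zeroProb_le_ofReal_hDownInt hν h0 h1 n w

lemma reflect_add_le (h1 : q ≤ 1) (g : ℤ → ℝ≥0∞) (M : ℝ≥0∞) (l : ℤ) :
    reflect q (fun w => g w + M) l ≤ reflect q g l + M := by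
  unfold reflect
  split_ifs
  · exact le_rfl
  · rw [mul_add]
    exact add_le_add_right (mul_le_of_le_one_left zero_le (ENNReal.ofReal_le_one.2 h1)) _

/-- The points at which the difference to the trapping probability is maximal are stable under
steps to the left. -/
lemma eq_trapProb_add_pred (hν : 0 < ν (-1)) (h1 : q ≤ 1) {H : ℤ → ℝ≥0∞} {M : ℝ≥0∞} {w : ℤ}
    (hw : 0 < w) (hle : ∀ l, H l ≤ trapProb ν q l + M)
    (hH : H w = ∑' k, ν k * reflect q H (w + k)) (hfin : H w ≠ ∞)
    (heq : H w = trapProb ν q w + M) : H (w - 1) = trapProb ν q (w - 1) + M := by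
  have hterm : ∀ k, ν k * reflect q H (w + k) ≤ ν k * (reflect q (trapProb ν q) (w + k) + M) :=
    fun k => mul_le_mul_right ((reflect_mono le_rfl hle _).trans (reflect_add_le h1 _ _ _)) _
  have hsum : ∑' k, ν k * (reflect q (trapProb ν q) (w + k) + M) = H w := by
    simp only [mul_add]
    rw [ENNReal.tsum_add, ← trapProb_eq_tsum hw, ENNReal.tsum_mul_right, ν.tsum_coe, one_mul, heq]
  have href : ∀ g : ℤ → ℝ≥0∞, reflect q g (w + -1) = g (w - 1) := fun g => by
    rw [reflect, if_pos (by omega), ← sub_eq_add_neg]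
  refine (hle _).antisymm (not_lt.1 fun hlt => ?_)
  -- A strict deficit at w-1 would be weighted by ν(-1) > 0 and make one average strictly smaller
  -- than the other, although both equal the finite number H(w).
  refine (ENNReal.tsum_lt_tsum (hH ▸ hfin) hterm (i := -1) ?_).ne (hH.symm.trans hsum.symm)
  rw [href, href]
  exact (ENNReal.mul_lt_mul_iff_right hν.ne' (ν.apply_ne_top _)).2 hlt

lemma trapProb_natCast_of_lt_one (hν : IsAdmissible ν) (h0 : 0 ≤ q) (h1 : q < 1) (p : ℕ) :
    trapProb ν q p = ENNReal.ofReal (hDown q p) := by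
  set H : ℤ → ℝ≥0∞ := fun w => ENNReal.ofReal (hDownInt q w) with hHdef
  have hHnat : ∀ p : ℕ, H p = ENNReal.ofReal (hDown q p) := fun p => by
    simp only [hHdef, hDownInt]
    rw [if_neg (by omega), Int.toNat_natCast]
  rw [← hHnat]
  refine (trapProb_le_ofReal_hDownInt hν h0 h1 p).antisymm (tsub_eq_zero_iff_le.1 ?_)
  by_contra hp
  set D : ℕ → ℝ≥0∞ := fun p => H p - trapProb ν q p with hD
  -- This uses q < 1, since h is constant for q = 1. It ensures that a positive supremum of the
  -- difference is attained.
  have hDlim : Tendsto D atTop (𝓝 0) := by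
    refine tendsto_of_tendsto_of_tendsto_of_le_of_le tendsto_const_nhds ?_
      (fun _ => zero_le) (fun p => tsub_le_self (a := H p))
    simp only [hHnat]
    simpa using ENNReal.tendsto_ofReal (tendsto_hDown_atTop_zero (by linarith : -1 < q) h1)
  obtain ⟨m, hm⟩ : ∃ m, ∀ j, D j ≤ D m := by
    obtain ⟨N, hN⟩ := eventually_atTop.1 (hDlim.eventually_lt_const (pos_iff_ne_zero.2 hp))
    obtain ⟨m, -, hm⟩ := Finset.exists_max_image (Finset.range (N + p + 1)) D ⟨p, by simp⟩
    refine ⟨m, fun j => ?_⟩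
    by_cases hj : j < N
    · exact hm j (by simp; omega)
    · exact (hN j (not_lt.1 hj)).le.trans (hm p (by simp))
  have hle : ∀ l, H l ≤ trapProb ν q l + D m := by
    intro l
    rcases lt_or_ge l 0 with hl | hl
    · simp [hHdef, hDownInt, hl]
    · lift l to ℕ using hl
      exact tsub_le_iff_left.1 (hm l)
  -- Steps of -1 carry the maximal difference down to 0, where both functions are 1.
  have hdesc : ∀ j : ℕ, H j = trapProb ν q j + D m → H 0 = trapProb ν q 0 + D m := by
    intro j
    induction j with
    | zero => exact id
    | succ j ih =>
      intro h
      refine ih ?_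
      have h2 := eq_trapProb_add_pred hν.1 h1.le (w := (j + 1 : ℕ)) (by omega) hle ?_ (by simp [hHdef]) h
      · simpa using h2
      · have h3 := ofReal_hDownExt_eq_tsum hν h0 h1 (p := (j + 1 : ℕ)) (by omega)
        simp only [← reflect_ofReal_hDownInt h0] at h3
        rwa [reflect, if_pos (by omega), ← hHdef] at h3
  have h3 := hdesc m (add_tsub_cancel_of_le (trapProb_le_ofReal_hDownInt hν h0 h1 m)).symm
  rw [trapProb_zero, show H 0 = 1 by simp [hHdef, hDownInt, hDown_zero]] at h3
  have h4 : D m = 0 := by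
    refine (ENNReal.add_right_inj ENNReal.one_ne_top).1 ?_
    rw [← h3, add_zero]
  exact hp (le_zero_iff.1 (h4 ▸ hm p))

lemma trapProb_natCast (hν : IsAdmissible ν) (h0 : 0 ≤ q) (h1 : q ≤ 1) (p : ℕ) :
    trapProb ν q p = ENNReal.ofReal (hDown q p) := by
  rcases h1.lt_or_eq with h1 | rfl
  · exact trapProb_natCast_of_lt_one hν h0 h1 p
  refine le_antisymm ?_ ?_
  · rw [hDown_one, ENNReal.ofReal_one]
    refine iSup_le fun n => ?_
    generalize (p : ℤ) = w
    induction n generalizing w with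
    | zero => rw [zeroProb]; split_ifs <;> simp
    | succ n ih =>
      rw [zeroProb]
      split_ifs
      · rw [← ν.tsum_coe]
        refine ENNReal.tsum_le_tsum fun k => mul_le_of_le_one_right zero_le ?_
        rw [reflect]
        split_ifs
        · exact ih _
        · simpa using ih _
      · exact ih w
  -- For q = 1 the lower bound comes from q ↑ 1: h is continuous in q, and the trapping probability
  -- increases with q.
  · have hlim : Tendsto (fun q => ENNReal.ofReal (hDown q p)) (𝓝[<] 1)
        (𝓝 (ENNReal.ofReal (hDown 1 p))) := by
      refine ENNReal.tendsto_ofReal ?_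
      have h := (continuousOn_hDown p) 1 (by norm_num)
      refine h.mono_left (nhdsWithin_le_iff.2 ?_)
      filter_upwards [Ioo_mem_nhdsLT (show (-1 : ℝ) < 1 by norm_num)] with x hx
      exact ⟨hx.1.le, hx.2.le⟩
    refine le_of_tendsto hlim ?_
    filter_upwards [Ioo_mem_nhdsLT (show (0 : ℝ) < 1 by norm_num)] with x hx
    rw [← trapProb_natCast_of_lt_one hν hx.1.le hx.2]
    exact iSup_mono fun n => zeroProb_mono_right hx.2.le n p

end

end Ricochet

end

theorem proposition4p4 :
    -- the probability of being trapped at `0`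
    (∀ ν : PMF ℤ, Ricochet.IsAdmissible ν → ∀ (q : I) (p : ℕ),
      Ricochet.walkLaw ν q p Ricochet.trappedAtZero = ENNReal.ofReal (Ricochet.hDown q p)) ∧
    -- the generating function, on the closed unit disc without the points `1` and `-1`
    (∀ q ∈ Set.Ioo (-1 : ℝ) 1, ∀ x : ℂ, ‖x‖ ≤ 1 → x ≠ 1 → x ≠ -1 →
      Tendsto (fun n : ℕ => ∑ p ∈ Finset.range n, (Ricochet.hDown q p : ℂ) * x ^ (2 * p)) atTop
        (𝓝 (1 / (1 + (q : ℂ)) *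
          ((q : ℂ) + Complex.cosh (2 * ((Ricochet.bExp q : ℂ) - 1) * Ricochet.cartanh x))))) ∧
    -- analyticity and continuity in the parameter
    (∀ p : ℕ, AnalyticOnNhd ℝ (fun q : ℝ => Ricochet.hDown q p) (Set.Ioo (-1) 1) ∧
      ContinuousOn (fun q : ℝ => Ricochet.hDown q p) (Set.Icc (-1) 1)) ∧
    -- bounds
    (∀ q ∈ Set.Icc (0 : ℝ) 1, ∀ p : ℕ, Ricochet.hDown q p ∈ Set.Ioc (0 : ℝ) 1) ∧
    -- asymptotics, for each parameter and uniformly on compact subintervals of `(-1, 1]`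
    (∀ q ∈ Set.Ioc (-1 : ℝ) 1,
      (fun p : ℕ => Ricochet.hDown q p) ~[atTop]
        (fun p : ℕ => Ricochet.rConst q * (p : ℝ) ^ (-Ricochet.bExp q))) ∧
    (∀ a c : ℝ, -1 < a → a ≤ c → c ≤ 1 →
      TendstoUniformlyOn
        (fun (p : ℕ) (q : ℝ) =>
          Ricochet.hDown q p / (Ricochet.rConst q * (p : ℝ) ^ (-Ricochet.bExp q)))
        (fun _ => 1) atTop (Set.Icc a c)) := by
  refine ⟨fun ν hν q p => ?_, fun q hq x hx hx1 hx2 => ?_, fun p => ⟨?_, ?_⟩, fun q hq p => ?_,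
    fun q hq => ?_, fun a c ha _ hc => ?_⟩
  · rw [Ricochet.walkLaw_trappedAtZero]
    exact Ricochet.trapProb_natCast hν q.2.1 q.2.2 p
  · exact Ricochet.tendsto_sum_hDown hq hx hx1 hx2
  · exact Ricochet.analyticOnNhd_hDown p
  · exact Ricochet.continuousOn_hDown p
  · exact Ricochet.hDown_mem_Ioc (by linarith [hq.1]) hq.2 p
  · exact Ricochet.isEquivalent_hDown hq
  · exact Ricochet.tendstoUniformlyOn_hDown ha hc
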